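/- Let $\mathbb{K}$ be $\mathbb{R}$ or $\mathbb{C}$; all normed spaces and algebras are over $\mathbb{K}$, and operators are bounded and linear. For a family $(F_\gamma)_{\gamma\in\Gamma}$ of Banach spaces, $(\bigoplus_\gamma F_\gamma)_{c_0}$ is the space of families $x=(x_\gamma)$ with $x_\gamma\in F_\gamma$ such that $\{\gamma:\|x_\gamma\|\ge\varepsilon\}$ is finite for each $\varepsilon>0$, with norm $\sup_\gamma\|x_\gamma\|$, and $(\bigoplus_\gamma F_\gamma)_{\ell_1}$ is the space of families with $\|x\|=\sum_\gamma\|x_\gamma\|<\infty$. Put $c_0(\Gamma)=(\bigoplus_{\gamma\in\Gamma}\mathbb{K})_{c_0}$, $\ell_1(\Gamma)=(\bigoplus_{\gamma\in\Gamma}\mathbb{K})_{\ell_1}$, $c_0=c_0(\mathbb{N})$ and $\ell_1=\ell_1(\mathbb{N})$. For Banach spaces $X,Y$, let $\mathscr{K}(X,Y)$ be the compact operators in the space $\mathscr{B}(X,Y)$ of operators $X\to Y$; the essential norm of $T\in\mathscr{B}(X,Y)$ is the quotient norm $\|T\|_e=\|T+\mathscr{K}(X,Y)\|$, and the Calkin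 algebra of $X$ is $\mathscr{B}(X)/\mathscr{K}(X)$ with the quotient norm, where $\mathscr{B}(X)=\mathscr{B}(X,X)$ and $\mathscr{K}(X)=\mathscr{K}(X,X)$. A normed algebra $\mathscr{A}$ has the $C$-IFP (idempotent factorization property with constant $C\ge1$) if for every $a\in\mathscr{A}$ with $\|a\|=1$ there are $b,c\in\mathscr{A}$ with $\|b\|\,\|c\|\le C$ such that $bac$ is a non-zero idempotent. It is uniformly incompressible if there is a function $f\colon(0,\infty)\to(0,\infty)$ such that every continuous, injective homomorphism $\varphi$ from $\mathscr{A}$ into a normed algebra satisfies $\|\varphi(a)\|\ge f(\|\varphi\|)\,\|a\|$ for all $a\in\mathscr{A}$. Let $E=c_0$ or $E=\ell_1$. (1) Let $X=(\bigoplus_{\gamma\in\Gamma}F_\gamma)_E$ and $Y=(\bigoplus_{\xi\in\Xi}G_\xi)_E$, where $\Gamma$ and $\Xi$ are infinite sets and all $F_\gamma$ and $G_\xi$ are non-zero, finite-dimensional Banach spaces. Then, for every non-compact $T\in\mathscr{B}(X,Y)$ with $\|T\|_e=1$ and every constant $C>1$, there are operators $U\in\mathscr{B}(Y,E)$ and $V\in\mathscr{B}(E,X)$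 such that $UTV=I_E$ and $\|U\|\,\|V\|\le C$. (2) Let $\Gamma$ be any set (possibly empty), and let $E_\Gamma=c_0(\Gamma)$ if $E=c_0$ and $E_\Gamma=\ell_1(\Gamma)$ if $E=\ell_1$. Let $X=(\bigoplus_{n\ge1}\ell_2^n)_E\oplus E_\Gamma$, normed by $\|(x,y)\|=\max\{\|x\|,\|y\|\}$ if $E=c_0$ and by $\|(x,y)\|=\|x\|+\|y\|$ if $E=\ell_1$. Then, for every non-compact $T\in\mathscr{B}(X)$ with $\|T\|_e=1$ and every constant $C>1$, there are operators $U\in\mathscr{B}(X,E)$ and $V\in\mathscr{B}(E,X)$ such that $UTV=I_E$ and $\|U\|\,\|V\|\le C$. Consequently the Calkin algebra of $X$ has the $C$-IFP for every $C>1$ and is uniformly incompressible. -/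

import Mathlib

open scoped ENNReal

noncomputable section

namespace CalkinIFP

/-! ### The direct sums -/

section DirectSums

variable (𝕜 : Type*) [RCLike 𝕜] {ι : Type*} (G : ι → Type*)
  [∀ i, NormedAddCommGroup (G i)] [∀ i, NormedSpace 𝕜 (G i)]

/-- The families `(x i)` in the bounded product of the `G i` for which `{i | ε ≤ ‖x i‖}` is finite
for each `ε > 0`. -/
def c0Submodule : Submodule 𝕜 (lp G ∞) where
  carrier := {x | ∀ ε : ℝ, 0 < ε → {i | ε ≤ ‖x i‖}.Finite}
  add_mem' := by
    intro x y hx hy ε hε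
    refine ((hx (ε / 2) (by positivity)).union (hy (ε / 2) (by positivity))).subset ?_
    intro i hi
    simp only [Set.mem_ofPred_eq, Set.mem_union, lp.coeFn_add, Pi.add_apply] at hi ⊢
    by_contra! h
    linarith [norm_add_le (x i) (y i), h.1, h.2]
  zero_mem' := by
    intro ε hε
    convert Set.finite_empty
    ext i
    simpa using hε
  smul_mem' := by
    intro c x hx ε hε
    refine (hx (ε / (‖c‖ + 1)) (by positivity)).subset ?_
    intro i hi
    simp only [Set.mem_ofPred_eq, lp.coeFn_smul, Pi.smul_apply, norm_smul] at hi ⊢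
    rw [div_le_iff₀ (by positivity)]
    nlinarith [norm_nonneg (x i), norm_nonneg c]

/-- The `c₀`-direct sum of a family of normed spaces, with the supremum norm. -/
abbrev C0Sum : Type _ := c0Submodule 𝕜 G

/-- The `ℓ₁`-direct sum of a family of normed spaces, with the norm `∑ ‖x i‖`. -/
abbrev L1Sum : Type _ := lp G 1

end DirectSums

section Completeness

variable {𝕜 : Type*} [RCLike 𝕜] {ι : Type*} {G : ι → Type*}
  [∀ i, NormedAddCommGroup (G i)] [∀ i, NormedSpace 𝕜 (G i)]

theorem isClosed_c0Submodule : IsClosed (c0Submodule 𝕜 G : Set (lp G ∞)) := by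
  refine isClosed_of_closure_subset fun x hx ε hε => ?_
  obtain ⟨y, hy, hxy⟩ := Metric.mem_closure_iff.1 hx (ε / 2) (by positivity)
  refine (hy (ε / 2) (by positivity)).subset ?_
  intro i hi
  simp only [Set.mem_ofPred_eq] at hi ⊢
  have h1 : ‖(x - y) i‖ ≤ ‖x - y‖ := lp.norm_apply_le_norm (by simp) (x - y) i
  rw [← dist_eq_norm] at h1
  have h2 : ‖x i‖ ≤ ‖(x - y) i‖ + ‖y i‖ := by
    simpa using norm_add_le ((x - y) i) (y i)
  linarith

instance [∀ i, CompleteSpace (G i)] : CompleteSpace (C0Sum 𝕜 G) :=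
  (isClosed_c0Submodule (𝕜 := 𝕜) (G := G)).completeSpace_coe

end Completeness

/-! ### Essential norm and factorization of an identity operator -/

section Factorization

/-- The norm of `T + K(X, Y)` in the quotient of `B(X, Y)` by the compact operators. -/
def essNorm {𝕜 X Y : Type*} [RCLike 𝕜] [NormedAddCommGroup X] [NormedSpace 𝕜 X]
    [NormedAddCommGroup Y] [NormedSpace 𝕜 Y] (T : X →L[𝕜] Y) : ℝ :=
  ‖(Submodule.Quotient.mk T : (X →L[𝕜] Y) ⧸ compactOperator (RingHom.id 𝕜) X Y)‖

/-- For every `C > 1`, the identity of `E` factors with constant `C` through every non-compact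
operator from `X` to `Y` of essential norm `1`. -/
def IdentityFactors (𝕜 E X Y : Type*) [RCLike 𝕜] [NormedAddCommGroup E] [NormedSpace 𝕜 E]
    [NormedAddCommGroup X] [NormedSpace 𝕜 X] [NormedAddCommGroup Y] [NormedSpace 𝕜 Y] : Prop :=
  ∀ T : X →L[𝕜] Y, ¬ IsCompactOperator T → essNorm T = 1 → ∀ C : ℝ, 1 < C →
    ∃ (U : Y →L[𝕜] E) (V : E →L[𝕜] X),
      U ∘L T ∘L V = ContinuousLinearMap.id 𝕜 E ∧ ‖U‖ * ‖V‖ ≤ C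

end Factorization

/-! ### The Calkin algebra -/

section Calkin

variable (𝕜 X : Type*) [RCLike 𝕜] [NormedAddCommGroup X] [NormedSpace 𝕜 X]

/-- The ideal of compact operators in the algebra of bounded operators on `X`. -/
def compactIdeal : Ideal (X →L[𝕜] X) where
  carrier := {T | IsCompactOperator T}
  add_mem' hS hT := hS.add hT
  zero_mem' := isCompactOperator_zero
  smul_mem' S _ hT := hT.clm_comp S

instance : (compactIdeal 𝕜 X).IsTwoSided :=
  ⟨fun {T} S (hT : IsCompactOperator T) => hT.comp_clm S⟩

instance [CompleteSpace X] : IsClosed (compactIdeal 𝕜 X : Set (X →L[𝕜] X)) :=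
  isClosed_setOfPred_isCompactOperator

/-- The Calkin algebra `B(X) / K(X)`, with the quotient norm. -/
abbrev Calkin : Type _ := (X →L[𝕜] X) ⧸ compactIdeal 𝕜 X

theorem Calkin.norm_mul_le' (a b : Calkin 𝕜 X) : ‖a * b‖ ≤ ‖a‖ * ‖b‖ := by
  have key : ∀ ε : ℝ, 0 < ε → ‖a * b‖ ≤ (‖a‖ + ε) * (‖b‖ + ε) := by
    intro ε hε
    obtain ⟨S, rfl, hS⟩ := Submodule.Quotient.norm_mk_lt a hε
    obtain ⟨T, rfl, hT⟩ := Submodule.Quotient.norm_mk_lt b hε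
    calc _ = ‖(Submodule.Quotient.mk (S * T) : Calkin 𝕜 X)‖ := rfl
      _ ≤ ‖S * T‖ := Submodule.Quotient.norm_mk_le _ _
      _ ≤ ‖S‖ * ‖T‖ := norm_mul_le S T
      _ ≤ _ := by gcongr
  have h1 : Filter.Tendsto (fun ε : ℝ => (‖a‖ + ε) * (‖b‖ + ε)) (nhdsWithin 0 (Set.Ioi 0))
      (nhds ((‖a‖ + 0) * (‖b‖ + 0))) :=
    (Continuous.tendsto (by fun_prop) 0).mono_left nhdsWithin_le_nhds
  have h2 := ge_of_tendsto h1 (eventually_nhdsWithin_of_forall key)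
  simpa using h2

instance [CompleteSpace X] : NormedRing (Calkin 𝕜 X) where
  __ := Ideal.Quotient.ring (compactIdeal 𝕜 X)
  __ := Submodule.Quotient.normedAddCommGroup (compactIdeal 𝕜 X)
  norm_mul_le := Calkin.norm_mul_le' 𝕜 X

instance [CompleteSpace X] : NormedAlgebra 𝕜 (Calkin 𝕜 X) where
  __ := Ideal.Quotient.algebra 𝕜 (I := compactIdeal 𝕜 X)
  norm_smul_le := (Submodule.Quotient.normedSpace (compactIdeal 𝕜 X) 𝕜).norm_smul_le

end Calkin

/-! ### Properties of normed algebras -/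

section NormedAlgebras

/-- The idempotent factorization property with constant `C`: for each `a` of norm `1` there are
`b`, `c` with `‖b‖ * ‖c‖ ≤ C` such that `b * a * c` is a non-zero idempotent. -/
def HasIFP (C : ℝ) (A : Type*) [NonUnitalNormedRing A] : Prop :=
  ∀ a : A, ‖a‖ = 1 → ∃ b c : A, ‖b‖ * ‖c‖ ≤ C ∧ b * a * c ≠ 0 ∧ IsIdempotentElem (b * a * c)

/-- Uniform incompressibility: there is `f : (0, ∞) → (0, ∞)` such that every continuous injective
homomorphism `φ` from `A` into a normed algebra is bounded below by `f ‖φ‖`. The norms of normed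
algebras are submultiplicative, and no identity element is required. -/
def UniformlyIncompressible.{w, u, v} (𝕜 : Type u) [RCLike 𝕜] (A : Type v)
    [NonUnitalNormedRing A] [NormedSpace 𝕜 A] : Prop :=
  ∃ f : ℝ → ℝ, (∀ t, 0 < t → 0 < f t) ∧
    ∀ (B : Type w) [NonUnitalNormedRing B] [NormedSpace 𝕜 B] [IsScalarTower 𝕜 B B]
      [SMulCommClass 𝕜 B B] (φ : A →L[𝕜] B),
      (∀ a b : A, φ (a * b) = φ a * φ b) → Function.Injective φ →
        ∀ a : A, f ‖φ‖ * ‖a‖ ≤ ‖φ a‖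

end NormedAlgebras

/-! ### The spaces -/

section Spaces

variable (𝕜 : Type*) [RCLike 𝕜]

/-- The Banach space `c₀(Γ)`. -/
abbrev C0 (Γ : Type*) : Type _ := C0Sum 𝕜 (fun _ : Γ => 𝕜)

/-- The Banach space `ℓ₁(Γ)`. -/
abbrev L1 (Γ : Type*) : Type _ := L1Sum (fun _ : Γ => 𝕜)

/-- The direct sum of `(⨁ ℓ₂ⁿ)_{c₀}`, over `n = 1, 2, …`, and `c₀(Γ)`, with the maximum norm. -/
abbrev HilbertC0 (Γ : Type*) : Type _ :=
  C0Sum 𝕜 (fun n : ℕ => EuclideanSpace 𝕜 (Fin (n + 1))) × C0 𝕜 Γ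

/-- The direct sum of `(⨁ ℓ₂ⁿ)_{ℓ₁}`, over `n = 1, 2, …`, and `ℓ₁(Γ)`, with the sum norm. -/
abbrev HilbertL1 (Γ : Type*) : Type _ :=
  WithLp 1 (L1Sum (fun n : ℕ => EuclideanSpace 𝕜 (Fin (n + 1))) × L1 𝕜 Γ)

end Spaces

end CalkinIFP

end

universe w u v₁ v₂ v₃ v₄ v₅

noncomputable section

namespace CalkinIFP

/-! ### Essential norm -/

section EssentialNorm

variable {𝕜 X Y : Type*} [RCLike 𝕜] [NormedAddCommGroup X] [NormedSpace 𝕜 X]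
  [NormedAddCommGroup Y] [NormedSpace 𝕜 Y]

/-! The summands provide mutually orthogonal compact projections, so deleting finitely many blocks
on either side of `T` changes it only by a compact operator. All these compressions therefore have
norm at least `‖T‖_e = 1` (`essNorm_le_norm_tail`). With `K = √C`, a gliding hump yields vectors `x
n` in the unit ball and functionals `g n`, disjointly supported and of norm at most `K`, such that
the matrix `g m (T (x n))` has unit diagonal and tiny off-diagonal entries. Then `V` sends the unit
vectors to the `x n`, `U` has coordinates `g n`, and `U T V` is close enough to the identity to be
inverted at the cost of a second factor `K`.

For `c₀`, `V` is bounded because the `x n` are disjointly supported, and `U` lands in `c₀` because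
each `g n` lives on one block. For `ℓ₁`, `V` is bounded for any `x n` in the ball; the difficulty is
to make the images `T (x n)` nearly disjoint. They are half-differences of vectors whose images are
close to a common coordinatewise limit `w` on large finite sets; since disjoint norms add in `ℓ₁`,
halving loses almost nothing (`IsL1Decomposition.exists_hump`).

For the Calkin algebra, a factorization `Q J = I_E` through `I_X` turns `U T V = I_E` into `(J U) T
(V Q) = J Q`, a non-compact idempotent. Incompressibility follows since non-zero idempotents have
norm at least `1`. -/

theorem essNorm_le_norm_of_isCompactOperator_sub {T S : X →L[𝕜] Y}
    (h : IsCompactOperator (T - S)) : essNorm T ≤ ‖S‖ := by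
  have e : (Submodule.Quotient.mk T : (X →L[𝕜] Y) ⧸ compactOperator (RingHom.id 𝕜) X Y)
      = Submodule.Quotient.mk S :=
    (Submodule.Quotient.eq _).2 h
  rw [essNorm, e]
  exact Submodule.Quotient.norm_mk_le _ _

/-- The ideal and the submodule of compact operators have the same carrier, so both quotient norms
are the same infimum. -/
theorem norm_mk_compactIdeal (T : X →L[𝕜] X) :
    ‖(Submodule.Quotient.mk T : Calkin 𝕜 X)‖ = essNorm T :=
  rfl

end EssentialNorm

/-! ### Families of mutually orthogonal compact projections -/

section Blocks

variable {𝕜 X ι : Type*} [RCLike 𝕜] [NormedAddCommGroup X] [NormedSpace 𝕜 X]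

/-- Mutually orthogonal compact idempotents. -/
structure IsBlockFamily (p : ι → X →L[𝕜] X) : Prop where
  idem : ∀ i x, p i (p i x) = p i x
  orth : ∀ i j, i ≠ j → ∀ x, p i (p j x) = 0
  compact : ∀ i, IsCompactOperator (p i)

/-- The sum of the projections over a finite set of indices. -/
def partialProj (p : ι → X →L[𝕜] X) (A : Finset ι) : X →L[𝕜] X := ∑ i ∈ A, p i

variable {p : ι → X →L[𝕜] X}

theorem partialProj_apply (A : Finset ι) (x : X) : partialProj p A x = ∑ i ∈ A, p i x := by
  simp [partialProj]

theorem isCompactOperator_partialProj (hp : ∀ i, IsCompactOperator (p i)) (A : Finset ι) :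
    IsCompactOperator (partialProj p A) :=
  (compactOperator (RingHom.id 𝕜) X X).sum_mem (t := A) (f := fun i => (p i : X →L[𝕜] X))
    fun i _ => hp i

open Classical in
theorem IsBlockFamily.apply_partialProj (hp : IsBlockFamily p) (A : Finset ι) (i : ι) (x : X) :
    p i (partialProj p A x) = if i ∈ A then p i x else 0 := by
  rw [partialProj_apply, map_sum]
  split_ifs with h
  · rw [Finset.sum_eq_single_of_mem i h fun j _ hj => hp.orth i j hj.symm x, hp.idem]
  · exact Finset.sum_eq_zero fun j hj => hp.orth i j (fun e => h (e ▸ hj)) x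

/-- The essential norm is a lower bound for the norm of a compression to tails. -/
theorem essNorm_le_norm_tail {Y κ : Type*} [NormedAddCommGroup Y] [NormedSpace 𝕜 Y]
    {q : κ → Y →L[𝕜] Y} (hp : ∀ i, IsCompactOperator (p i)) (hq : ∀ i, IsCompactOperator (q i))
    (T : X →L[𝕜] Y) (A : Finset ι) (B : Finset κ) :
    essNorm T ≤ ‖(ContinuousLinearMap.id 𝕜 Y - partialProj q B) ∘L T ∘L
      (ContinuousLinearMap.id 𝕜 X - partialProj p A)‖ := by
  refine essNorm_le_norm_of_isCompactOperator_sub ?_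
  -- With `P`, `Q` the partial projections, `T - (1 - Q) T (1 - P) = Q T + (1 - Q) T P`, and both
  -- terms are compact.
  have h1 : IsCompactOperator (partialProj q B ∘L T) :=
    (isCompactOperator_partialProj hq B).comp_clm T
  have h2 : IsCompactOperator (((ContinuousLinearMap.id 𝕜 Y - partialProj q B) ∘L T) ∘L
      partialProj p A) :=
    (isCompactOperator_partialProj hp A).clm_comp
      ((ContinuousLinearMap.id 𝕜 Y - partialProj q B) ∘L T)
  convert! h1.add h2 using 1
  ext x
  simp only [sub_apply, ContinuousLinearMap.comp_apply,
    ContinuousLinearMap.id_apply, map_sub, Pi.add_apply]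
  abel

/-- A tail of an operator into a space with blocks is nearly normed by a vector. -/
theorem exists_lt_norm_tail {Y κ : Type*} [NormedAddCommGroup Y] [NormedSpace 𝕜 Y]
    {q : κ → Y →L[𝕜] Y} (hp : ∀ i, IsCompactOperator (p i)) (hq : ∀ i, IsCompactOperator (q i))
    (T : X →L[𝕜] Y) (A : Finset ι) (B : Finset κ) {r : ℝ} (hr : r < essNorm T) :
    ∃ x : X, ‖x‖ ≤ 1 ∧ r < ‖T (x - partialProj p A x) -
      partialProj q B (T (x - partialProj p A x))‖ := by
  obtain ⟨x, hx, h⟩ := ContinuousLinearMap.exists_lt_apply_of_lt_opNorm _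
    (hr.trans_le (essNorm_le_norm_tail hp hq T A B))
  exact ⟨x, hx.le, h⟩

end Blocks

/-! ### Inverting small perturbations of the identity -/

section Perturbation

variable {𝕜 E : Type*} [RCLike 𝕜] [NormedAddCommGroup E] [NormedSpace 𝕜 E] [CompleteSpace E]

/-- Invertibility is the Neumann series; the norm bound comes from `R` being bounded below by `1 -
η`. -/
theorem exists_left_inverse_of_norm_sub_le {R : E →L[𝕜] E} {η : ℝ} (hη0 : 0 ≤ η) (hη : η < 1)
    (h : ∀ x, ‖R x - x‖ ≤ η * ‖x‖) :
    ∃ S : E →L[𝕜] E, S ∘L R = ContinuousLinearMap.id 𝕜 E ∧ ‖S‖ ≤ (1 - η)⁻¹ := by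
  have h1 : ‖(1 : E →L[𝕜] E) - R‖ < 1 := by
    refine (ContinuousLinearMap.opNorm_le_bound _ hη0 fun x => ?_).trans_lt hη
    have := h x
    rw [norm_sub_rev] at this
    simpa using this
  obtain ⟨u, hu⟩ : IsUnit R := by
    simpa using isUnit_one_sub_of_norm_lt_one h1
  have hl : (↑u⁻¹ : E →L[𝕜] E) * R = 1 := by rw [← hu, Units.inv_mul]
  have hr : R * (↑u⁻¹ : E →L[𝕜] E) = 1 := by rw [← hu, Units.mul_inv]
  refine ⟨↑u⁻¹, hl, ContinuousLinearMap.opNorm_le_bound _ (inv_nonneg.2 (by linarith)) fun y => ?_⟩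
  have e : R ((↑u⁻¹ : E →L[𝕜] E) y) = y := DFunLike.congr_fun hr y
  have h2 := h ((↑u⁻¹ : E →L[𝕜] E) y)
  rw [e, norm_sub_rev] at h2
  rw [inv_mul_eq_div, le_div_iff₀ (by linarith)]
  have := norm_le_norm_add_norm_sub' ((↑u⁻¹ : E →L[𝕜] E) y) y
  linarith

/-- An approximate factorization of the identity can be corrected to an exact one. -/
theorem exists_factorization_of_approx {X Y : Type*} [NormedAddCommGroup X] [NormedSpace 𝕜 X]
    [NormedAddCommGroup Y] [NormedSpace 𝕜 Y] {T : X →L[𝕜] Y} {U : Y →L[𝕜] E} {V : E →L[𝕜] X}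
    {K : ℝ} (hK : 1 < K) (hU : ‖U‖ ≤ K) (hV : ‖V‖ ≤ 1)
    (h : ∀ x, ‖U (T (V x)) - x‖ ≤ (1 - K⁻¹) * ‖x‖) :
    ∃ (U : Y →L[𝕜] E) (V : E →L[𝕜] X),
      U ∘L T ∘L V = ContinuousLinearMap.id 𝕜 E ∧ ‖U‖ * ‖V‖ ≤ K * K := by
  have hK0 : 0 < K := by linarith
  obtain ⟨S, hS, hSn⟩ := exists_left_inverse_of_norm_sub_le (R := U ∘L T ∘L V)
    (by linarith [inv_lt_one_of_one_lt₀ hK]) (by linarith [inv_pos.2 hK0]) h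
  refine ⟨S ∘L U, V, hS, ?_⟩
  have hSK : ‖S‖ ≤ K := by simpa using hSn
  calc ‖S ∘L U‖ * ‖V‖ ≤ (‖S‖ * ‖U‖) * ‖V‖ := by
        gcongr; exact ContinuousLinearMap.opNorm_comp_le _ _
    _ ≤ (K * K) * 1 := by gcongr
    _ = K * K := mul_one _

theorem hasSum_half_pow_succ (c : ℝ) : HasSum (fun n : ℕ => c * (1 / 2 : ℝ) ^ (n + 1)) c := by
  have e : (fun n : ℕ => c * (1 / 2 : ℝ) ^ (n + 1)) = fun n => c / 2 / 2 ^ n := by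
    ext n
    rw [pow_succ, one_div, inv_pow]
    field_simp
  rw [e]
  exact hasSum_geometric_two' c

/-- Coordinatewise estimate for a matrix close to the identity matrix. -/
theorem norm_apply_sub_le_of_matrix {X : Type*} [NormedAddCommGroup X] [NormedSpace 𝕜 X]
    {v : ℕ → X} {g : ℕ → X →L[𝕜] 𝕜} {η : ℝ} (hgv : ∀ n, g n (v n) = 1)
    (hoff : ∀ m n, m ≠ n → ‖g m (v n)‖ ≤ η * (1 / 2) ^ (m + 1) * (1 / 2) ^ (n + 1))
    {a : ℕ → 𝕜} {x : X} (hx : HasSum (fun n => a n • v n) x) {M : ℝ} (hη : 0 ≤ η)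
    (hM : ∀ n, ‖a n‖ ≤ M) (m : ℕ) : ‖g m x - a m‖ ≤ η * (1 / 2) ^ (m + 1) * M := by
  have h1 : HasSum (fun n => a n * g m (v n)) (g m x) := by
    simpa using (g m).hasSum hx
  -- Subtracting this series removes the diagonal term and leaves the off-diagonal ones.
  have h2 : HasSum (fun n => if n = m then a m else 0) (a m) := hasSum_ite_eq m (a m)
  refine (h1.sub h2).norm_le_of_bounded (hasSum_half_pow_succ (η * (1 / 2) ^ (m + 1) * M))
    fun n => ?_
  have hM0 : 0 ≤ M := (norm_nonneg _).trans (hM 0)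
  split_ifs with e
  · subst e
    rw [hgv, mul_one, sub_self, norm_zero]
    positivity
  · rw [sub_zero, norm_mul]
    calc _ ≤ M * (η * (1 / 2) ^ (m + 1) * (1 / 2) ^ (n + 1)) := by
          gcongr
          · exact hM n
          · exact hoff m n (Ne.symm e)
      _ = _ := by ring

end Perturbation

/-! ### Operators into and out of `c₀` and `ℓ₁` -/

section SequenceSpaces

variable {𝕜 X : Type*} [RCLike 𝕜] [NormedAddCommGroup X] [NormedSpace 𝕜 X]

theorem C0Sum.norm_apply_le {ι : Type*} {G : ι → Type*} [∀ i, NormedAddCommGroup (G i)]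
    [∀ i, NormedSpace 𝕜 (G i)] (x : C0Sum 𝕜 G) (i : ι) : ‖x.1 i‖ ≤ ‖x‖ :=
  lp.norm_apply_le_norm ENNReal.top_ne_zero x.1 i

theorem C0Sum.norm_le {ι : Type*} {G : ι → Type*} [∀ i, NormedAddCommGroup (G i)]
    [∀ i, NormedSpace 𝕜 (G i)] {x : C0Sum 𝕜 G} {r : ℝ} (hr : 0 ≤ r) (h : ∀ i, ‖x.1 i‖ ≤ r) :
    ‖x‖ ≤ r :=
  lp.norm_le_of_forall_le hr h

theorem L1Sum.hasSum_norm {ι : Type*} {G : ι → Type*} [∀ i, NormedAddCommGroup (G i)]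
    (x : L1Sum G) : HasSum (fun i => ‖x i‖) ‖x‖ := by
  simpa using lp.hasSum_norm (by simp) x

theorem L1Sum.norm_le {ι : Type*} {G : ι → Type*} [∀ i, NormedAddCommGroup (G i)]
    {x : L1Sum G} {g : ι → ℝ} {r : ℝ} (hg : HasSum g r) (h : ∀ i, ‖x i‖ ≤ g i) : ‖x‖ ≤ r :=
  hasSum_le h (L1Sum.hasSum_norm x) hg

theorem exists_clm_to_C0 {g : ℕ → X →L[𝕜] 𝕜} {K : ℝ} (hK : 0 ≤ K)
    (hg : ∀ n x, ‖g n x‖ ≤ K * ‖x‖) (hfin : ∀ x, ∀ ε : ℝ, 0 < ε → {n | ε ≤ ‖g n x‖}.Finite) :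
    ∃ U : X →L[𝕜] C0 𝕜 ℕ, ‖U‖ ≤ K ∧ ∀ x n, (U x).1 n = g n x := by
  let f : X →ₗ[𝕜] C0 𝕜 ℕ :=
    { toFun := fun x => ⟨⟨fun n => g n x, memℓp_infty ⟨K * ‖x‖, by
        rintro _ ⟨n, rfl⟩
        exact hg n x⟩⟩, hfin x⟩
      map_add' := fun x y => by
        ext n
        exact map_add (g n) x y
      map_smul' := fun c x => by
        ext n
        exact map_smul (g n) c x }
  exact ⟨f.mkContinuous K fun x => C0Sum.norm_le (by positivity) fun n => hg n x,
    LinearMap.mkContinuous_norm_le _ hK _, fun _ _ => rfl⟩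

theorem exists_clm_to_L1 {g : ℕ → X →L[𝕜] 𝕜} {K : ℝ} (hK : 0 ≤ K)
    (hg : ∀ (s : Finset ℕ) x, ∑ n ∈ s, ‖g n x‖ ≤ K * ‖x‖) :
    ∃ U : X →L[𝕜] L1 𝕜 ℕ, ‖U‖ ≤ K ∧ ∀ x n, U x n = g n x := by
  have hs : ∀ x, Summable fun n => ‖g n x‖ := fun x =>
    summable_of_sum_le (fun _ => norm_nonneg _) fun s => hg s x
  let f : X →ₗ[𝕜] L1 𝕜 ℕ :=
    { toFun := fun x => ⟨fun n => g n x, memℓp_gen (by simpa using hs x)⟩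
      map_add' := fun x y => by
        ext n
        exact map_add (g n) x y
      map_smul' := fun c x => by
        ext n
        exact map_smul (g n) c x }
  exact ⟨f.mkContinuous K fun x => (L1Sum.norm_le (hs x).hasSum fun n => le_rfl).trans
      ((hs x).tsum_le_of_sum_le fun s => hg s x),
    LinearMap.mkContinuous_norm_le _ hK _, fun _ _ => rfl⟩

/-- A linear map defined by a pointwise convergent bounded series. -/
theorem exists_clm_of_hasSum {E : Type*} [NormedAddCommGroup E] [NormedSpace 𝕜 E]
    (c : ℕ → E →ₗ[𝕜] 𝕜) (v : ℕ → X) (hs : ∀ a, Summable fun n => c n a • v n)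
    (hb : ∀ a, ∀ s : Finset ℕ, ‖∑ n ∈ s, c n a • v n‖ ≤ ‖a‖) :
    ∃ V : E →L[𝕜] X, ‖V‖ ≤ 1 ∧ ∀ a, HasSum (fun n => c n a • v n) (V a) := by
  let f : E →ₗ[𝕜] X :=
    { toFun := fun a => ∑' n, c n a • v n
      map_add' := fun a b => by
        rw [← (hs a).tsum_add (hs b)]
        simp [add_smul]
      map_smul' := fun t a => by
        rw [RingHom.id_apply, ← (hs a).tsum_const_smul]
        simp [mul_smul] }
  exact ⟨f.mkContinuous 1 fun a => by
      rw [one_mul]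
      exact le_of_tendsto (hs a).hasSum.norm (Filter.Eventually.of_forall (hb a)),
    LinearMap.mkContinuous_norm_le _ zero_le_one _, fun a => (hs a).hasSum⟩

theorem exists_clm_of_L1 [CompleteSpace X] {v : ℕ → X} (hv : ∀ n, ‖v n‖ ≤ 1) :
    ∃ V : L1 𝕜 ℕ →L[𝕜] X, ‖V‖ ≤ 1 ∧ ∀ a, HasSum (fun n => a n • v n) (V a) := by
  have hle : ∀ (a : L1 𝕜 ℕ) n, ‖a n • v n‖ ≤ ‖a n‖ := fun a n => by
    rw [norm_smul]
    exact mul_le_of_le_one_right (norm_nonneg _) (hv n)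
  refine exists_clm_of_hasSum (fun n =>
    { toFun := fun a : L1 𝕜 ℕ => a n, map_add' := fun _ _ => rfl, map_smul' := fun _ _ => rfl }) v
    (fun a => (L1Sum.hasSum_norm a).summable.of_norm_bounded (hle a)) fun a s => ?_
  calc _ ≤ ∑ n ∈ s, ‖a n‖ := norm_sum_le_of_le _ fun n _ => hle a n
    _ ≤ ‖a‖ := sum_le_hasSum s (fun _ _ => norm_nonneg _) (L1Sum.hasSum_norm a)

theorem exists_clm_of_C0 [CompleteSpace X] {v : ℕ → X}
    (hv : ∀ (a : ℕ → 𝕜) (s : Finset ℕ) (M : ℝ), 0 ≤ M → (∀ n ∈ s, ‖a n‖ ≤ M) →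
      ‖∑ n ∈ s, a n • v n‖ ≤ M) :
    ∃ V : C0 𝕜 ℕ →L[𝕜] X, ‖V‖ ≤ 1 ∧ ∀ a, HasSum (fun n => a.1 n • v n) (V a) := by
  refine exists_clm_of_hasSum (fun n =>
    { toFun := fun a : C0 𝕜 ℕ => a.1 n, map_add' := fun _ _ => rfl, map_smul' := fun _ _ => rfl }) v
    (fun a => summable_iff_vanishing_norm.2 fun ε hε => ?_) fun a s => ?_
  · have hf := a.2 (ε / 2) (by positivity)
    refine ⟨hf.toFinset, fun t ht => (hv _ t (ε / 2) (by positivity) fun n hn => ?_).trans_lt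
      (by linarith)⟩
    have : n ∉ hf.toFinset := Finset.disjoint_left.1 ht hn
    simp only [Set.Finite.mem_toFinset, Set.mem_ofPred_eq, not_le] at this
    exact this.le
  · exact hv _ s _ (norm_nonneg _) fun n _ => C0Sum.norm_apply_le a n

end SequenceSpaces

/-! ### Decompositions of `c₀` type -/

section C0Decomposition

variable {𝕜 X ι : Type*} [RCLike 𝕜] [NormedAddCommGroup X] [NormedSpace 𝕜 X]

/-- The projections onto the summands of a `c₀`-direct sum. -/
structure IsC0Decomposition (p : ι → X →L[𝕜] X) : Prop extends IsBlockFamily p where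
  norm_apply_le : ∀ x i, ‖p i x‖ ≤ ‖x‖
  norm_le : ∀ x (r : ℝ), 0 ≤ r → (∀ i, ‖p i x‖ ≤ r) → ‖x‖ ≤ r
  finite : ∀ x (ε : ℝ), 0 < ε → {i | ε ≤ ‖p i x‖}.Finite

namespace IsC0Decomposition

variable {p : ι → X →L[𝕜] X} (hp : IsC0Decomposition p)
include hp

theorem apply_sub_partialProj_of_mem {A : Finset ι} {i : ι} (hi : i ∈ A) (x : X) :
    p i (x - partialProj p A x) = 0 := by
  rw [map_sub, hp.apply_partialProj, if_pos hi, sub_self]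

theorem apply_sub_partialProj_of_notMem {A : Finset ι} {i : ι} (hi : i ∉ A) (x : X) :
    p i (x - partialProj p A x) = p i x := by
  rw [map_sub, hp.apply_partialProj, if_neg hi, sub_zero]

theorem norm_partialProj_le (A : Finset ι) (x : X) : ‖partialProj p A x‖ ≤ ‖x‖ := by
  refine hp.norm_le _ _ (norm_nonneg _) fun i => ?_
  rw [hp.apply_partialProj]
  split_ifs
  · exact hp.norm_apply_le x i
  · simp

theorem norm_sub_partialProj_le (A : Finset ι) (x : X) : ‖x - partialProj p A x‖ ≤ ‖x‖ := by
  refine hp.norm_le _ _ (norm_nonneg _) fun i => ?_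
  by_cases hi : i ∈ A
  · simp [hp.apply_sub_partialProj_of_mem hi]
  · rw [hp.apply_sub_partialProj_of_notMem hi]
    exact hp.norm_apply_le x i

/-- This is where a `c₀`-sum differs from an `ℓ∞`-sum: only finitely many blocks of `x` exceed a
given size. -/
theorem tendsto_partialProj (x : X) :
    Filter.Tendsto (fun A => partialProj p A x) Filter.atTop (nhds x) := by
  refine Metric.tendsto_nhds.2 fun ε hε => ?_
  filter_upwards [Filter.eventually_ge_atTop (hp.finite x (ε / 2) (by positivity)).toFinset]
    with A hA
  rw [dist_eq_norm, norm_sub_rev]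
  refine (hp.norm_le _ (ε / 2) (by positivity) fun i => ?_).trans_lt (by linarith)
  by_cases hi : i ∈ A
  · rw [hp.apply_sub_partialProj_of_mem hi, norm_zero]
    positivity
  · rw [hp.apply_sub_partialProj_of_notMem hi]
    by_contra! h
    exact hi (hA ((Set.Finite.mem_toFinset _).2 h.le))

/-- In a supremum norm a single block witnesses that a tail is large, so a functional on one block
suffices. -/
theorem exists_notMem_lt_norm_apply {B : Finset ι} {y : X} {r : ℝ} (hr : 0 ≤ r)
    (h : r < ‖y - partialProj p B y‖) : ∃ i ∉ B, r < ‖p i y‖ := by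
  by_contra! hc
  refine absurd (hp.norm_le _ r hr fun i => ?_) (not_le.2 h)
  by_cases hi : i ∈ B
  · simpa [hp.apply_sub_partialProj_of_mem hi] using hr
  · rw [hp.apply_sub_partialProj_of_notMem hi]
    exact hc i hi

/-- A functional is small on the vectors supported off a suitable finite set. -/
theorem exists_norm_functional_le (f : X →L[𝕜] 𝕜) {δ : ℝ} (hδ : 0 < δ) :
    ∃ A : Finset ι, ∀ x, (∀ i ∈ A, p i x = 0) → ‖x‖ ≤ 1 → ‖f x‖ ≤ δ := by
  obtain ⟨z, hz, hfz⟩ : ∃ z, ‖z‖ < 1 ∧ ‖f‖ - δ < ‖f z‖ :=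
    f.exists_lt_apply_of_lt_opNorm (by linarith)
  obtain ⟨A, hA⟩ : ∃ A, ‖f‖ - δ < ‖f (partialProj p A z)‖ :=
    (((f.continuous.tendsto z).comp (hp.tendsto_partialProj z)).norm.eventually
      (lt_mem_nhds hfz)).exists
  refine ⟨A, fun x hx hx1 => ?_⟩
  set y := partialProj p A z
  -- Unimodular rotations make the values on the disjoint vectors `y` and `x` add up while the norm
  -- stays at most `1`. As `y` already uses up `‖f‖ - δ`, only `δ` is left for `x`.
  obtain ⟨c, hc, hc'⟩ := RCLike.exists_norm_eq_mul_self (f y)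
  obtain ⟨d, hd, hd'⟩ := RCLike.exists_norm_eq_mul_self (f x)
  have h1 : ‖c • y + d • x‖ ≤ 1 := by
    refine hp.norm_le _ 1 zero_le_one fun i => ?_
    rw [map_add, map_smul, map_smul]
    by_cases hi : i ∈ A
    · rw [hx i hi, smul_zero, add_zero, norm_smul, hc, one_mul]
      exact (hp.norm_apply_le y i).trans ((hp.norm_partialProj_le A z).trans hz.le)
    · rw [hp.apply_partialProj, if_neg hi, smul_zero, zero_add, norm_smul, hd, one_mul]
      exact (hp.norm_apply_le x i).trans hx1
  have h2 : ‖f (c • y + d • x)‖ ≤ ‖f‖ := by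
    simpa using f.le_opNorm_of_le h1
  have h3 : f (c • y + d • x) = ((‖f y‖ + ‖f x‖ : ℝ) : 𝕜) := by
    rw [map_add, map_smul, map_smul, smul_eq_mul, smul_eq_mul, ← hc', ← hd']
    push_cast
    rfl
  rw [h3, RCLike.norm_ofReal, abs_of_nonneg (by positivity)] at h2
  linarith

/-- Disjointly supported vectors of norm at most one satisfy an upper `c₀` estimate. -/
theorem norm_sum_smul_le {v : ℕ → X} {A : ℕ → Set ι} (hA : ∀ n, ∀ i ∉ A n, p i (v n) = 0)
    (hd : Pairwise fun m n => Disjoint (A m) (A n)) (hv : ∀ n, ‖v n‖ ≤ 1) (a : ℕ → 𝕜)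
    (s : Finset ℕ) (M : ℝ) (hM : 0 ≤ M) (ha : ∀ n ∈ s, ‖a n‖ ≤ M) :
    ‖∑ n ∈ s, a n • v n‖ ≤ M := by
  refine hp.norm_le _ M hM fun i => ?_
  simp only [map_sum, map_smul]
  by_cases hi : ∃ n ∈ s, i ∈ A n
  · obtain ⟨n, hn, hin⟩ := hi
    rw [Finset.sum_eq_single_of_mem n hn fun m _ hmn => by
      rw [hA m i fun h => Set.disjoint_left.1 (hd hmn) h hin, smul_zero], norm_smul]
    calc _ ≤ M * 1 := by
          gcongr
          · exact ha n hn
          · exact (hp.norm_apply_le _ i).trans (hv n)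
      _ = M := mul_one M
  · push Not at hi
    rw [Finset.sum_eq_zero fun n hn => by rw [hA n i (hi n hn), smul_zero], norm_zero]
    exact hM

end IsC0Decomposition

/-- The data chosen at each stage of a gliding hump argument: a level, a vector, a functional,
and finite supports of both. -/
structure HumpData (𝕜 X Y ι κ : Type*) [RCLike 𝕜] [NormedAddCommGroup Y] [NormedSpace 𝕜 Y] where
  /-- the level of precision -/
  level : ℕ
  /-- the vector -/
  vec : X
  /-- a support of the vector -/
  supp : Finset ι
  /-- the functional -/
  fnl : Y →L[𝕜] 𝕜
  /-- a support of the functional -/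
  fsupp : Finset κ

/-- The relation between a datum and a later one in a gliding hump argument. -/
structure HumpData.Before {𝕜 X Y ι κ : Type*} [RCLike 𝕜] [NormedAddCommGroup X] [NormedSpace 𝕜 X]
    [NormedAddCommGroup Y] [NormedSpace 𝕜 Y] (T : X →L[𝕜] Y) (η : ℝ)
    (a b : HumpData 𝕜 X Y ι κ) : Prop where
  level : a.level < b.level
  supp : Disjoint a.supp b.supp
  fsupp : Disjoint a.fsupp b.fsupp
  left : ‖a.fnl (T b.vec)‖ ≤ η * (1 / 4) ^ (b.level + 1)
  right : ‖b.fnl (T a.vec)‖ ≤ η * (1 / 4) ^ (b.level + 1)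

/-- Levels increase strictly, so the later datum, of index `n > m`, has level at least `n`, and
`(1/4)^(n+1) ≤ (1/2)^(m+1) (1/2)^(n+1)`. Recording the level makes the decay available from pairwise
relations alone. -/
theorem HumpData.norm_fnl_le {𝕜 X Y ι κ : Type*} [RCLike 𝕜] [NormedAddCommGroup X]
    [NormedSpace 𝕜 X] [NormedAddCommGroup Y] [NormedSpace 𝕜 Y] {T : X →L[𝕜] Y} {η : ℝ}
    (hη : 0 ≤ η) {d : ℕ → HumpData 𝕜 X Y ι κ} (h : ∀ m n, m < n → (d m).Before T η (d n))
    (m n : ℕ) (hmn : m ≠ n) :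
    ‖(d m).fnl (T (d n).vec)‖ ≤ η * (1 / 2) ^ (m + 1) * (1 / 2) ^ (n + 1) := by
  have hl : StrictMono fun n => (d n).level := fun m n hmn => (h m n hmn).level
  have key : ∀ m n : ℕ, m < n →
      η * (1 / 4) ^ ((d n).level + 1) ≤ η * (1 / 2) ^ (m + 1) * (1 / 2) ^ (n + 1) := by
    intro m n hmn
    rw [mul_assoc, ← pow_add]
    have e : (1 / 4 : ℝ) ^ ((d n).level + 1) = (1 / 2) ^ (2 * ((d n).level + 1)) := by
      rw [pow_mul]
      norm_num
    rw [e]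
    refine mul_le_mul_of_nonneg_left (pow_le_pow_of_le_one (by norm_num) (by norm_num) ?_) hη
    have := hl.id_le n
    simp only [id] at this
    omega
  rcases hmn.lt_or_gt with hlt | hlt
  · exact (h m n hlt).left.trans (key m n hlt)
  · refine (h n m hlt).right.trans ((key n m hlt).trans_eq ?_)
    ring

theorem HumpData.pairwise_disjoint_supp {𝕜 X Y ι κ : Type*} [RCLike 𝕜] [NormedAddCommGroup X]
    [NormedSpace 𝕜 X] [NormedAddCommGroup Y] [NormedSpace 𝕜 Y] {T : X →L[𝕜] Y} {η : ℝ}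
    {d : ℕ → HumpData 𝕜 X Y ι κ} (h : ∀ m n, m < n → (d m).Before T η (d n)) :
    (Pairwise fun m n => Disjoint (d m).supp (d n).supp) ∧
      Pairwise fun m n => Disjoint (d m).fsupp (d n).fsupp :=
  ⟨fun m n hmn => hmn.lt_or_gt.elim (fun hlt => (h m n hlt).supp) fun hlt => (h n m hlt).supp.symm,
    fun m n hmn => hmn.lt_or_gt.elim (fun hlt => (h m n hlt).fsupp)
      fun hlt => (h n m hlt).fsupp.symm⟩

variable {Y κ : Type*} [NormedAddCommGroup Y] [NormedSpace 𝕜 Y]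

open Classical in
-- Earlier functionals composed with `T` are small on vectors vanishing on `A`, and earlier images
-- are small on blocks outside `B`. A tail of `T` avoiding both still has norm at least `1`, so it
-- supplies the next vector and block.
theorem IsC0Decomposition.exists_next {p : ι → X →L[𝕜] X} {q : κ → Y →L[𝕜] Y}
    (hp : IsC0Decomposition p) (hq : IsC0Decomposition q) (T : X →L[𝕜] Y) (hT : essNorm T = 1)
    {K η : ℝ} (hK : 1 < K) (hη : 0 < η) (s : Finset (HumpData 𝕜 X Y ι κ)) :
    ∃ b : HumpData 𝕜 X Y ι κ, (‖b.vec‖ ≤ 1 ∧ (∀ i ∉ b.supp, p i b.vec = 0) ∧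
      b.fnl (T b.vec) = 1 ∧ ∃ j, b.fsupp = {j} ∧ ∀ y, ‖b.fnl y‖ ≤ K * ‖q j y‖) ∧
      ∀ a ∈ s, a.Before T η b := by
  have hK0 : 0 < K := by linarith
  set k := s.sup HumpData.level + 1
  set δ : ℝ := η * (1 / 4) ^ (k + 1) with hδ
  have hδ0 : 0 < δ := by positivity
  have htail : ∀ a : HumpData 𝕜 X Y ι κ, ∃ A : Finset ι, ∀ x, (∀ i ∈ A, p i x = 0) → ‖x‖ ≤ 1 →
      ‖a.fnl (T x)‖ ≤ δ := fun a => hp.exists_norm_functional_le (a.fnl ∘L T) hδ0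
  choose A₁ hA₁ using htail
  set A : Finset ι := s.biUnion fun a => a.supp ∪ A₁ a
  set B : Finset κ := s.biUnion fun a =>
    a.fsupp ∪ (hq.finite (T a.vec) (δ / K) (by positivity)).toFinset
  obtain ⟨x₀, hx₀, hlt⟩ := exists_lt_norm_tail hp.compact hq.compact T A B
    (r := K⁻¹) (hT ▸ inv_lt_one_of_one_lt₀ hK)
  set x₁ := x₀ - partialProj p A x₀
  have hx₁ : ‖x₁‖ ≤ 1 := (hp.norm_sub_partialProj_le A x₀).trans hx₀
  -- A strict inequality between continuous quantities survives truncation to finitely many blocks.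
  obtain ⟨A', hA'⟩ : ∃ A', K⁻¹ < ‖T (partialProj p A' x₁) -
      partialProj q B (T (partialProj p A' x₁))‖ := by
    have hc : Continuous fun x => ‖T x - partialProj q B (T x)‖ := by fun_prop
    exact (((hc.tendsto x₁).comp (hp.tendsto_partialProj x₁)).eventually
      (lt_mem_nhds hlt)).exists
  set x := partialProj p A' x₁
  have hx : ‖x‖ ≤ 1 := (hp.norm_partialProj_le A' x₁).trans hx₁
  have hxA : ∀ i ∈ A, p i x = 0 := fun i hi => by
    rw [hp.apply_partialProj, hp.apply_sub_partialProj_of_mem hi, ite_self]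
  obtain ⟨j, hj, hjx⟩ := hq.exists_notMem_lt_norm_apply (inv_nonneg.2 hK0.le) hA'
  -- Normalizing to value `1` at `T x` costs at most `K`, since the block has norm above `K⁻¹`;
  -- hence the tolerance `δ / K` in `B`.
  obtain ⟨g, hg, hgx⟩ := exists_dual_vector'' 𝕜 (q j (T x))
  have hpos : 0 < ‖q j (T x)‖ := (inv_pos.2 hK0).trans hjx
  have hgb : ∀ y, ‖((‖q j (T x)‖ : 𝕜)⁻¹ • (g ∘L q j)) y‖ ≤ K * ‖q j y‖ := fun y => by
    have h1 : ‖g (q j y)‖ ≤ 1 * ‖q j y‖ := g.le_of_opNorm_le hg _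
    rw [smul_apply, norm_smul, norm_inv, RCLike.norm_ofReal,
      abs_of_pos hpos]
    have h2 : ‖q j (T x)‖⁻¹ ≤ K := (inv_le_comm₀ hK0 hpos).1 hjx.le
    rw [one_mul] at h1
    exact mul_le_mul h2 h1 (norm_nonneg _) hK0.le
  refine ⟨⟨k, x, A' \ A, (‖q j (T x)‖ : 𝕜)⁻¹ • (g ∘L q j), {j}⟩, ⟨hx, fun i hi => ?_, ?_, j, rfl,
    hgb⟩, fun a ha => ⟨?_, ?_, ?_, ?_, ?_⟩⟩
  · by_cases hiA : i ∈ A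
    · exact hxA i hiA
    · rw [hp.apply_partialProj, if_neg fun h => hi (Finset.mem_sdiff.2 ⟨h, hiA⟩)]
  · have : (‖q j (T x)‖ : 𝕜) ≠ 0 := by exact_mod_cast hpos.ne'
    simp [hgx, this]
  · exact Nat.lt_succ_of_le (Finset.le_sup (f := HumpData.level) ha)
  · refine Finset.disjoint_left.2 fun i hi hi' => (Finset.mem_sdiff.1 hi').2 ?_
    exact Finset.mem_biUnion.2 ⟨a, ha, Finset.mem_union_left _ hi⟩
  · refine Finset.disjoint_singleton_right.2 fun h => hj ?_
    exact Finset.mem_biUnion.2 ⟨a, ha, Finset.mem_union_left _ h⟩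
  · exact hA₁ a x (fun i hi => hxA i (Finset.mem_biUnion.2 ⟨a, ha, Finset.mem_union_right _ hi⟩)) hx
  · refine (hgb _).trans ?_
    rw [← le_div_iff₀' hK0]
    by_contra! hc
    refine hj (Finset.mem_biUnion.2 ⟨a, ha, Finset.mem_union_right _ ?_⟩)
    exact (Set.Finite.mem_toFinset _).2 hc.le

theorem IsC0Decomposition.identityFactors [CompleteSpace X] {p : ι → X →L[𝕜] X}
    {q : κ → Y →L[𝕜] Y} (hp : IsC0Decomposition p) (hq : IsC0Decomposition q) :
    IdentityFactors 𝕜 (C0 𝕜 ℕ) X Y := by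
  intro T _ hT C hC
  -- One factor `K` bounds `U`; the other is the correction `(1 - η)⁻¹` with `η = 1 - K⁻¹`.
  set K := √C
  have hK : 1 < K := Real.lt_sqrt_of_sq_lt (by simpa using hC)
  have hK0 : 0 < K := by linarith
  have hKC : K * K = C := Real.mul_self_sqrt (by linarith)
  have hη : 0 < 1 - K⁻¹ := by linarith [inv_lt_one_of_one_lt₀ hK]
  obtain ⟨d, hd, hdr⟩ := exists_seq_of_forall_finset_exists _ _ fun s _ =>
    hp.exists_next hq T hT hK hη s
  choose hv hsupp hone j hj hfb using hd
  obtain ⟨hd1, hd2⟩ := HumpData.pairwise_disjoint_supp hdr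
  have hjinj : Function.Injective j := fun m n hmn => by
    by_contra hne
    have := hd2 hne
    simp [hj, hmn] at this
  obtain ⟨V, hV, hVs⟩ := exists_clm_of_C0 (v := fun n => (d n).vec)
    (hp.norm_sum_smul_le (𝕜 := 𝕜) (A := fun n => ((d n).supp : Set ι))
      (fun n i hi => hsupp n i hi) (fun m n hmn => Finset.disjoint_coe.2 (hd1 hmn)) hv)
  obtain ⟨U, hU, hUs⟩ := exists_clm_to_C0 (g := fun n => (d n).fnl) hK0.le
    (fun n y => (hfb n y).trans (by gcongr; exact hq.norm_apply_le y _)) fun y ε hε => by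
      -- The blocks `j n` are distinct, so only finitely many of them can carry a large part of `y`.
      refine ((hq.finite y (ε / K) (by positivity)).preimage hjinj.injOn).subset fun n hn => ?_
      exact (div_le_iff₀' hK0).2 (le_trans hn (hfb n y))
  rw [← hKC]
  refine exists_factorization_of_approx hK hU hV fun a => ?_
  refine C0Sum.norm_le (by positivity) fun m => ?_
  have h1 := norm_apply_sub_le_of_matrix (g := fun n => (d n).fnl)
    (v := fun n => T (d n).vec) hone (HumpData.norm_fnl_le hη.le hdr) (a := fun n => a.1 n)
    (by simpa using T.hasSum (hVs a)) hη.le (C0Sum.norm_apply_le a) m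
  have h2 : (U (T (V a)) - a).1 m = (d m).fnl (T (V a)) - a.1 m := by
    rw [← hUs]
    rfl
  rw [h2]
  refine h1.trans ?_
  gcongr
  exact mul_le_of_le_one_right hη.le (pow_le_one₀ (by norm_num) (by norm_num))

end C0Decomposition

/-! ### Decompositions of `ℓ₁` type -/

section L1Decomposition

variable {𝕜 X ι : Type*} [RCLike 𝕜] [NormedAddCommGroup X] [NormedSpace 𝕜 X]

/-- The projections onto the summands of an `ℓ₁`-direct sum. -/
structure IsL1Decomposition (p : ι → X →L[𝕜] X) : Prop extends IsBlockFamily p where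
  hasSum_norm : ∀ x, HasSum (fun i => ‖p i x‖) ‖x‖

namespace IsL1Decomposition

variable {p : ι → X →L[𝕜] X} (hp : IsL1Decomposition p)
include hp

theorem norm_partialProj (A : Finset ι) (x : X) : ‖partialProj p A x‖ = ∑ i ∈ A, ‖p i x‖ := by
  classical
  refine (hp.hasSum_norm _).unique ?_
  have : (fun i => ‖p i (partialProj p A x)‖) = fun i => if i ∈ A then ‖p i x‖ else 0 := by
    ext i
    rw [hp.apply_partialProj]
    split_ifs <;> simp
  rw [this]
  rw [← Finset.sum_congr rfl fun i hi => if_pos (c := i ∈ A) hi]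
  exact hasSum_sum_of_ne_finset_zero fun i hi => if_neg hi

theorem norm_partialProj_add_norm_sub (A : Finset ι) (x : X) :
    ‖partialProj p A x‖ + ‖x - partialProj p A x‖ = ‖x‖ := by
  classical
  refine ((hp.hasSum_norm _).add (hp.hasSum_norm _)).unique ?_
  have : (fun i => ‖p i (partialProj p A x)‖ + ‖p i (x - partialProj p A x)‖) =
      fun i => ‖p i x‖ := by
    ext i
    rw [map_sub, hp.apply_partialProj]
    split_ifs <;> simp
  rw [this]
  exact hp.hasSum_norm x

theorem norm_partialProj_mono {A B : Finset ι} (h : A ⊆ B) (x : X) :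
    ‖partialProj p A x‖ ≤ ‖partialProj p B x‖ := by
  rw [hp.norm_partialProj, hp.norm_partialProj]
  exact Finset.sum_le_sum_of_subset_of_nonneg h fun _ _ _ => norm_nonneg _

theorem norm_partialProj_le_norm_sub {A B : Finset ι} (h : Disjoint A B) (x : X) :
    ‖partialProj p B x‖ ≤ ‖x - partialProj p A x‖ := by
  classical
  have h1 := hp.norm_partialProj_add_norm_sub A x
  have h2 := hp.norm_partialProj_add_norm_sub (A ∪ B) x
  rw [hp.norm_partialProj (A ∪ B), Finset.sum_union h, ← hp.norm_partialProj,
    ← hp.norm_partialProj] at h2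
  linarith [norm_nonneg (x - partialProj p (A ∪ B) x)]

theorem tendsto_norm_sub_partialProj (x : X) :
    Filter.Tendsto (fun A => ‖x - partialProj p A x‖) Filter.atTop (nhds 0) := by
  have h : Filter.Tendsto (fun A => ‖x‖ - ∑ i ∈ A, ‖p i x‖) Filter.atTop (nhds (‖x‖ - ‖x‖)) :=
    tendsto_const_nhds.sub (hp.hasSum_norm x)
  rw [sub_self] at h
  refine h.congr fun A => ?_
  rw [← hp.norm_partialProj, ← hp.norm_partialProj_add_norm_sub A x]
  ring

theorem exists_superset_norm_sub_lt (A₀ : Finset ι) (x : X) {ε : ℝ} (hε : 0 < ε) :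
    ∃ A, A₀ ⊆ A ∧ ‖x - partialProj p A x‖ < ε :=
  ((Filter.eventually_ge_atTop A₀).and
    ((hp.tendsto_norm_sub_partialProj x).eventually (gt_mem_nhds hε))).exists

/-- Bounded nets have coordinatewise limits along ultrafilters. -/
theorem exists_coordinatewise_limit [CompleteSpace X] {α : Type*} (𝒰 : Ultrafilter α) {z : α → X}
    {M : ℝ} (hz : ∀ a, ‖z a‖ ≤ M) :
    ∃ w : X, ∀ i, Filter.Tendsto (fun a => p i (z a)) 𝒰 (nhds (p i w)) := by
  have h1 : ∀ i, ∃ y, Filter.Tendsto (fun a => p i (z a)) 𝒰 (nhds y) := fun i => by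
    -- Each coordinate stays in a compact set, so the ultrafilter has a limit there.
    obtain ⟨Q, hQ, hsub⟩ := (hp.compact i).image_closedBall_subset_compact
      (f := (p i : X →ₗ[𝕜] X)) M
    obtain ⟨y, -, hy⟩ := isCompact_iff_ultrafilter_le_nhds.1 hQ (𝒰.map fun a => p i (z a)) (by
      rw [Filter.le_principal_iff]
      have hmem : ∀ a, p i (z a) ∈ Q := fun a =>
        hsub (Set.mem_image_of_mem _ (mem_closedBall_zero_iff.2 (hz a)))
      exact Filter.mem_map.2 (Filter.Eventually.of_forall hmem))
    exact ⟨y, hy⟩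
  choose y hy using h1
  have hidem : ∀ i, p i (y i) = y i := fun i => by
    refine tendsto_nhds_unique (((p i).continuous.tendsto _).comp (hy i)) ((hy i).congr fun a => ?_)
    exact (hp.idem i _).symm
  -- Fatou-type bound: finite partial sums pass to the limit and stay at most `M`.
  have hsum : Summable fun i => ‖y i‖ := by
    refine summable_of_sum_le (c := M) (fun _ => norm_nonneg _) fun s => ?_
    refine le_of_tendsto (tendsto_finsetSum s fun i _ => (hy i).norm)
      (Filter.Eventually.of_forall fun a => ?_)
    rw [← hp.norm_partialProj]
    exact (by linarith [hp.norm_partialProj_add_norm_sub s (z a), hz a,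
      norm_nonneg (z a - partialProj p s (z a))])
  refine ⟨∑' i, y i, fun i => ?_⟩
  have e : p i (∑' j, y j) = y i := by
    rw [(p i).map_tsum hsum.of_norm, tsum_eq_single i fun j hj => ?_, hidem]
    rw [← hidem j, hp.orth i j hj.symm]
  rw [e]
  exact hy i

theorem tendsto_partialProj_of_coordinatewise {α : Type*} {l : Filter α} {z : α → X} {w : X}
    (h : ∀ i, Filter.Tendsto (fun a => p i (z a)) l (nhds (p i w))) (A : Finset ι) :
    Filter.Tendsto (fun a => ‖partialProj p A (z a - w)‖) l (nhds 0) := by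
  simp only [hp.norm_partialProj]
  have := tendsto_finsetSum A fun i _ => ((h i).sub_const (p i w)).norm
  simpa using this

end IsL1Decomposition

variable {Y κ : Type*} [NormedAddCommGroup Y] [NormedSpace 𝕜 Y]

/-- Nearly disjoint vectors in the range of an operator, together with a limit. -/
theorem IsL1Decomposition.exists_limit [CompleteSpace Y] {q : κ → Y →L[𝕜] Y}
    (hq : IsL1Decomposition q) (T : X →L[𝕜] Y) (hT : essNorm T = 1) {r : ℝ} (hr : r < 1) :
    ∃ w : Y, ∀ (B : Finset κ) (ε : ℝ), 0 < ε → ∃ x : X, ‖x‖ ≤ 1 ∧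
      ‖partialProj q B (T x - w)‖ < ε ∧ r - ε < ‖T x - w‖ := by
  -- These sets are non-empty and decrease as `B` grows, so an ultrafilter contains them all; along
  -- it, mass at least `r` escapes every finite set of blocks.
  let S : Finset κ → Set {x : X // ‖x‖ ≤ 1} := fun B => {x | r < ‖T x - partialProj q B (T x)‖}
  have hS : ∀ B, (S B).Nonempty := fun B => by
    obtain ⟨x, hx, hlt⟩ := exists_lt_norm_tail (𝕜 := 𝕜) (ι := Empty) (p := fun _ => 0)
      (fun i => i.elim) hq.compact T ∅ B (hr.trans_eq hT.symm)
    refine ⟨⟨x, hx⟩, ?_⟩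
    show r < ‖T x - partialProj q B (T x)‖
    simpa [partialProj] using hlt
  have hmono : ∀ B C, B ⊆ C → S C ⊆ S B := fun B C hBC x hx => by
    have h1 := hq.norm_partialProj_add_norm_sub B (T x)
    have h2 := hq.norm_partialProj_add_norm_sub C (T x)
    have h3 := hq.norm_partialProj_mono hBC (T x)
    have h4 : r < ‖T x - partialProj q C (T x)‖ := hx
    show r < ‖T x - partialProj q B (T x)‖
    linarith
  have hne : (⨅ B, Filter.principal (S B)).NeBot := by
    classical
    refine Filter.iInf_neBot_of_directed' (fun B C => ⟨B ∪ C, ?_, ?_⟩) fun B =>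
      Filter.principal_neBot_iff.2 (hS B)
    · exact Filter.principal_mono.2 (hmono _ _ Finset.subset_union_left)
    · exact Filter.principal_mono.2 (hmono _ _ Finset.subset_union_right)
  let 𝒰 := Ultrafilter.of (⨅ B, Filter.principal (S B))
  have h𝒰 : ∀ B, ∀ᶠ x in (𝒰 : Filter {x : X // ‖x‖ ≤ 1}), x ∈ S B := fun B =>
    Filter.le_principal_iff.1 ((Ultrafilter.of_le _).trans (iInf_le _ B))
  obtain ⟨w, hw⟩ := hq.exists_coordinatewise_limit 𝒰 (z := fun x => T x.1) (M := ‖T‖)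
    fun x => by simpa using T.le_opNorm_of_le x.2
  refine ⟨w, fun B ε hε => ?_⟩
  -- Off `C` the limit `w` is negligible while `T x` still has norm above `r`, so subtracting `w`
  -- costs at most `ε`.
  obtain ⟨C, -, hC⟩ := hq.exists_superset_norm_sub_lt ∅ w hε
  obtain ⟨x, hx, hxS⟩ := (((hq.tendsto_partialProj_of_coordinatewise hw B).eventually
    (gt_mem_nhds hε)).and (h𝒰 C)).exists
  refine ⟨x, x.2, hx, ?_⟩
  have h1 := hq.norm_partialProj_add_norm_sub C (T x - w)
  have h2 : T x - w - partialProj q C (T x - w) =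
      (T x - partialProj q C (T x)) - (w - partialProj q C w) := by
    rw [map_sub]
    abel
  have h3 := norm_sub_norm_le (T x - partialProj q C (T x)) (w - partialProj q C w)
  rw [← h2] at h3
  have h4 : r < ‖T x - partialProj q C (T x)‖ := hxS
  linarith [norm_nonneg (partialProj q C (T x - w))]

/-- Differences of nearly disjoint vectors are almost disjoint from a given finite set of blocks,
and lose almost no norm. -/
theorem IsL1Decomposition.exists_hump [CompleteSpace Y] {q : κ → Y →L[𝕜] Y}
    (hq : IsL1Decomposition q) (T : X →L[𝕜] Y) (hT : essNorm T = 1) {r ε : ℝ} (hr : r < 1)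
    (hε : 0 < ε) (B : Finset κ) :
    ∃ x : X, ‖x‖ ≤ 1 ∧ ‖partialProj q B (T x)‖ < ε ∧ r - ε < ‖T x‖ := by
  set δ := ε / 4
  have hδ : 0 < δ := by positivity
  have hεδ : ε = 4 * δ := by
    simp only [δ]
    ring
  obtain ⟨w, hw⟩ := hq.exists_limit T hT hr
  obtain ⟨x, hx, hxB, hxr⟩ := hw B δ hδ
  -- `C` carries almost all of `T x - w`, and `y` is then taken with `T y - w` almost zero on `C`,
  -- so the two are nearly disjoint.
  obtain ⟨C, hBC, hC⟩ := hq.exists_superset_norm_sub_lt B (T x - w) hδ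
  obtain ⟨y, hy, hyC, hyr⟩ := hw C δ hδ
  have hTv : T ((2 : 𝕜)⁻¹ • (x - y)) = (2 : 𝕜)⁻¹ • ((T x - w) - (T y - w)) := by
    rw [map_smul, map_sub]
    congr 1
    abel
  have hn : ∀ v : Y, ‖(2 : 𝕜)⁻¹ • v‖ = ‖v‖ / 2 := fun v => by
    rw [norm_smul, norm_inv, RCLike.norm_ofNat, inv_mul_eq_div]
  have hn' : ∀ v : X, ‖(2 : 𝕜)⁻¹ • v‖ = ‖v‖ / 2 := fun v => by
    rw [norm_smul, norm_inv, RCLike.norm_ofNat, inv_mul_eq_div]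
  refine ⟨(2 : 𝕜)⁻¹ • (x - y), ?_, ?_, ?_⟩
  · rw [hn']
    linarith [norm_sub_le x y]
  · rw [hTv, map_smul, hn, map_sub]
    linarith [norm_sub_le (partialProj q B (T x - w)) (partialProj q B (T y - w)),
      hq.norm_partialProj_mono hBC (T y - w)]
  · rw [hTv, hn]
    generalize T x - w = a at *
    generalize T y - w = b at *
    -- Comparing on and off `C` gives `‖a - b‖ ≥ ‖a‖ + ‖b‖ - 4δ > 2r - 6δ`; half of it exceeds `r -
    -- ε`.
    have h1 := hq.norm_partialProj_add_norm_sub C (a - b)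
    have h2 := hq.norm_partialProj_add_norm_sub C a
    have h3 := hq.norm_partialProj_add_norm_sub C b
    have h4 : a - b - partialProj q C (a - b) =
        (a - partialProj q C a) - (b - partialProj q C b) := by
      rw [map_sub]
      abel
    rw [h4, map_sub] at h1
    have h5 := norm_sub_norm_le (partialProj q C a) (partialProj q C b)
    have h6 := norm_sub_norm_le (b - partialProj q C b) (a - partialProj q C a)
    rw [norm_sub_rev (b - _) (a - _)] at h6
    linarith

open Classical in
-- Both cross terms are controlled in the codomain: `B` contains the earlier functional supports and
-- nearly all of the earlier images, while the new image is nearly zero on `B`. The domain needs no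
-- supports, hence the index type `Empty`.
theorem IsL1Decomposition.exists_next [CompleteSpace Y] {q : κ → Y →L[𝕜] Y}
    (hq : IsL1Decomposition q) (T : X →L[𝕜] Y) (hT : essNorm T = 1)
    {K η : ℝ} (hK : 1 < K) (hη : 0 < η) (s : Finset (HumpData 𝕜 X Y Empty κ))
    (hs : ∀ a ∈ s, ∀ y, ‖a.fnl y‖ ≤ K * ‖partialProj q a.fsupp y‖) :
    ∃ b : HumpData 𝕜 X Y Empty κ, (‖b.vec‖ ≤ 1 ∧ b.fnl (T b.vec) = 1 ∧
      ∀ y, ‖b.fnl y‖ ≤ K * ‖partialProj q b.fsupp y‖) ∧ ∀ a ∈ s, a.Before T η b := by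
  have hK0 : 0 < K := by linarith
  have hK1 : K⁻¹ < 1 := inv_lt_one_of_one_lt₀ hK
  set k := s.sup HumpData.level + 1
  set δ : ℝ := η * (1 / 4) ^ (k + 1) with hδ
  have hδ0 : 0 < δ / K := by positivity
  choose B₁ hB₁ hB₁' using fun a : HumpData 𝕜 X Y Empty κ =>
    hq.exists_superset_norm_sub_lt a.fsupp (T a.vec) hδ0
  set B : Finset κ := s.biUnion B₁
  have hB : ∀ a ∈ s, B₁ a ⊆ B := fun a ha => Finset.subset_biUnion_of_mem B₁ ha
  set τ := (1 - K⁻¹) / 4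
  -- Four losses of at most `τ`: from `r`, from the hump's `ε`, from truncating to `C`, and from
  -- removing `B`.
  have hτ : K⁻¹ + 4 * τ = 1 := by
    simp only [τ]
    ring
  have hτ0 : 0 < τ := by
    simp only [τ]
    linarith
  obtain ⟨x, hx, hxB, hxr⟩ := hq.exists_hump T hT (r := 1 - τ) (ε := min τ (δ / K))
    (by linarith) (lt_min hτ0 hδ0) B
  obtain ⟨C, hBC, hC⟩ := hq.exists_superset_norm_sub_lt B (T x) hτ0
  set D := C \ B
  have hDB : Disjoint B D := Finset.disjoint_sdiff
  have hD : K⁻¹ < ‖partialProj q D (T x)‖ := by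
    have h1 := hq.norm_partialProj_add_norm_sub C (T x)
    have h2 : ‖partialProj q C (T x)‖ = ‖partialProj q D (T x)‖ + ‖partialProj q B (T x)‖ := by
      rw [hq.norm_partialProj, hq.norm_partialProj, hq.norm_partialProj, Finset.sum_sdiff hBC]
    linarith [min_le_left τ (δ / K)]
  obtain ⟨g, hg, hgx⟩ := exists_dual_vector'' 𝕜 (partialProj q D (T x))
  have hpos : 0 < ‖partialProj q D (T x)‖ := (inv_pos.2 hK0).trans hD
  have hgb : ∀ y, ‖((‖partialProj q D (T x)‖ : 𝕜)⁻¹ • (g ∘L partialProj q D)) y‖ ≤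
      K * ‖partialProj q D y‖ := fun y => by
    have h1 : ‖g (partialProj q D y)‖ ≤ 1 * ‖partialProj q D y‖ := g.le_of_opNorm_le hg _
    rw [smul_apply, norm_smul, norm_inv, RCLike.norm_ofReal, abs_of_pos hpos]
    have h2 : ‖partialProj q D (T x)‖⁻¹ ≤ K := (inv_le_comm₀ hK0 hpos).1 hD.le
    rw [one_mul] at h1
    exact mul_le_mul h2 h1 (norm_nonneg _) hK0.le
  refine ⟨⟨k, x, ∅, (‖partialProj q D (T x)‖ : 𝕜)⁻¹ • (g ∘L partialProj q D), D⟩, ⟨hx, ?_, hgb⟩,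
    fun a ha => ⟨?_, Finset.disjoint_empty_right _, ?_, ?_, ?_⟩⟩
  · have : (‖partialProj q D (T x)‖ : 𝕜) ≠ 0 := by exact_mod_cast hpos.ne'
    simp [hgx, this]
  · exact Nat.lt_succ_of_le (Finset.le_sup (f := HumpData.level) ha)
  · exact hDB.mono_left ((hB₁ a).trans (hB a ha))
  · refine (hs a ha _).trans ?_
    rw [← le_div_iff₀' hK0]
    exact (hq.norm_partialProj_mono ((hB₁ a).trans (hB a ha)) _).trans
      (hxB.le.trans (min_le_right _ _))
  · refine (hgb _).trans ?_
    rw [← le_div_iff₀' hK0]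
    exact (hq.norm_partialProj_le_norm_sub (hDB.mono_left (hB a ha)) _).trans (hB₁' a).le

theorem IsL1Decomposition.identityFactors [CompleteSpace X] [CompleteSpace Y]
    {q : κ → Y →L[𝕜] Y} (hq : IsL1Decomposition q) : IdentityFactors 𝕜 (L1 𝕜 ℕ) X Y := by
  intro T _ hT C hC
  set K := √C
  have hK : 1 < K := Real.lt_sqrt_of_sq_lt (by simpa using hC)
  have hK0 : 0 < K := by linarith
  have hKC : K * K = C := Real.mul_self_sqrt (by linarith)
  have hη : 0 < 1 - K⁻¹ := by linarith [inv_lt_one_of_one_lt₀ hK]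
  obtain ⟨d, hd, hdr⟩ := exists_seq_of_forall_finset_exists _ _ fun s hs =>
    hq.exists_next T hT hK hη s fun a ha => (hs a ha).2.2
  choose hv hone hfb using hd
  obtain ⟨-, hd2⟩ := HumpData.pairwise_disjoint_supp hdr
  obtain ⟨V, hV, hVs⟩ := exists_clm_of_L1 (𝕜 := 𝕜) (v := fun n => (d n).vec) hv
  obtain ⟨U, hU, hUs⟩ := exists_clm_to_L1 (g := fun n => (d n).fnl) hK0.le fun s y => by
    classical
    calc ∑ n ∈ s, ‖(d n).fnl y‖ ≤ ∑ n ∈ s, K * ‖partialProj q (d n).fsupp y‖ :=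
          Finset.sum_le_sum fun n _ => hfb n y
      _ = K * ‖partialProj q (s.biUnion fun n => (d n).fsupp) y‖ := by
          -- Disjointness of the functional supports lets the block norms add up to at most `‖y‖`,
          -- which bounds `U`.
          rw [← Finset.mul_sum, hq.norm_partialProj, Finset.sum_biUnion fun m _ n _ hmn => hd2 hmn]
          simp only [hq.norm_partialProj]
      _ ≤ K * ‖y‖ := by
          gcongr
          linarith [hq.norm_partialProj_add_norm_sub (s.biUnion fun n => (d n).fsupp) y,
            norm_nonneg (y - partialProj q (s.biUnion fun n => (d n).fsupp) y)]
  rw [← hKC]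
  refine exists_factorization_of_approx hK hU hV fun a => ?_
  refine L1Sum.norm_le (hasSum_half_pow_succ _) fun m => ?_
  have h1 := norm_apply_sub_le_of_matrix (g := fun n => (d n).fnl)
    (v := fun n => T (d n).vec) hone (HumpData.norm_fnl_le hη.le hdr) (a := fun n => a n)
    (by simpa using T.hasSum (hVs a)) hη.le (lp.norm_apply_le_norm one_ne_zero a) m
  have h2 : (U (T (V a)) - a) m = (d m).fnl (T (V a)) - a m := by
    rw [← hUs]
    rfl
  rw [h2]
  exact h1.trans_eq (by ring)

end L1Decomposition

/-! ### Concrete decompositions -/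

section Concrete

variable {𝕜 : Type*} [RCLike 𝕜]

theorem isCompactOperator_comp_of_finiteDimensional {X Y Z : Type*}
    [NormedAddCommGroup X] [NormedSpace 𝕜 X] [NormedAddCommGroup Y] [NormedSpace 𝕜 Y]
    [NormedAddCommGroup Z] [NormedSpace 𝕜 Z] [FiniteDimensional 𝕜 Y] (S : Y →L[𝕜] Z)
    (R : X →L[𝕜] Y) : IsCompactOperator (S ∘L R) := by
  have := FiniteDimensional.proper_rclike 𝕜 Y
  have h : IsCompactOperator (ContinuousLinearMap.id 𝕜 Y) := isCompactOperator_id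
  exact (h.comp_clm R).clm_comp S

variable {ι : Type*} {F : ι → Type*} [∀ i, NormedAddCommGroup (F i)] [∀ i, NormedSpace 𝕜 (F i)]

variable (𝕜 F) in
/-- The projection onto a coordinate of a `c₀`-direct sum. -/
def C0Sum.evalCLM (i : ι) : C0Sum 𝕜 F →L[𝕜] F i :=
  LinearMap.mkContinuous
    { toFun := fun x => x.1 i, map_add' := fun _ _ => rfl, map_smul' := fun _ _ => rfl } 1
    fun x => (C0Sum.norm_apply_le x i).trans_eq (one_mul _).symm

variable (𝕜 F) in
open Classical in
/-- The inclusion of a summand into a `c₀`-direct sum. -/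
def C0Sum.singleCLM (i : ι) : F i →L[𝕜] C0Sum 𝕜 F :=
  LinearMap.mkContinuous
    { toFun := fun y => ⟨lp.single ∞ i y, fun ε hε => by
        refine (Set.finite_singleton i).subset fun j hj => ?_
        by_contra hne
        rw [Set.mem_ofPred_eq, lp.single_apply_ne _ _ _ hne, norm_zero] at hj
        exact absurd hj (not_le.2 hε)⟩
      map_add' := fun y z => Subtype.ext (lp.single_add _ _ _ _)
      map_smul' := fun c y => Subtype.ext (lp.single_smul _ _ _ _) } 1
    fun y => by
      rw [one_mul]
      exact (lp.norm_single (by simp) i y).le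

theorem C0Sum.singleCLM_apply_self (i : ι) (y : F i) : (C0Sum.singleCLM 𝕜 F i y).1 i = y := by
  classical exact lp.single_apply_self _ _ _

theorem C0Sum.singleCLM_apply_ne {i j : ι} (h : j ≠ i) (y : F i) :
    (C0Sum.singleCLM 𝕜 F i y).1 j = 0 := by
  classical exact lp.single_apply_ne _ _ _ h

theorem C0Sum.norm_singleCLM_apply (i : ι) (y : F i) : ‖C0Sum.singleCLM 𝕜 F i y‖ = ‖y‖ := by
  classical exact lp.norm_single (by simp) i y

variable (𝕜 F) in
theorem C0Sum.isC0Decomposition [∀ i, FiniteDimensional 𝕜 (F i)] :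
    IsC0Decomposition fun i => C0Sum.singleCLM 𝕜 F i ∘L C0Sum.evalCLM 𝕜 F i where
  idem i x := congrArg (C0Sum.singleCLM 𝕜 F i) (C0Sum.singleCLM_apply_self (𝕜 := 𝕜) i _)
  orth i j h x := by
    have : C0Sum.evalCLM 𝕜 F i (C0Sum.singleCLM 𝕜 F j (C0Sum.evalCLM 𝕜 F j x)) = 0 :=
      C0Sum.singleCLM_apply_ne (𝕜 := 𝕜) h _
    simp [this]
  compact i := isCompactOperator_comp_of_finiteDimensional _ _
  norm_apply_le x i := (C0Sum.norm_singleCLM_apply i _).trans_le (C0Sum.norm_apply_le x i)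
  norm_le x r hr h := C0Sum.norm_le hr fun i => (C0Sum.norm_singleCLM_apply i _).symm.trans_le (h i)
  finite x ε hε := (x.2 ε hε).subset fun i hi =>
    le_trans (α := ℝ) hi (C0Sum.norm_singleCLM_apply i _).le

variable (𝕜 F) in
/-- The projection onto a coordinate of an `ℓ₁`-direct sum. -/
def L1Sum.evalCLM (i : ι) : L1Sum F →L[𝕜] F i :=
  LinearMap.mkContinuous
    { toFun := fun x => x i, map_add' := fun _ _ => rfl, map_smul' := fun _ _ => rfl } 1
    fun x => (lp.norm_apply_le_norm one_ne_zero x i).trans_eq (one_mul _).symm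

variable (𝕜 F) in
open Classical in
/-- The inclusion of a summand into an `ℓ₁`-direct sum. -/
def L1Sum.singleCLM (i : ι) : F i →L[𝕜] L1Sum F :=
  LinearMap.mkContinuous
    { toFun := fun y => lp.single 1 i y
      map_add' := fun y z => lp.single_add _ _ _ _
      map_smul' := fun c y => lp.single_smul _ _ _ _ } 1
    fun y => by
      rw [one_mul]
      exact (lp.norm_single (by simp) i y).le

theorem L1Sum.singleCLM_apply_self (i : ι) (y : F i) : L1Sum.singleCLM 𝕜 F i y i = y := by
  classical exact lp.single_apply_self _ _ _

theorem L1Sum.singleCLM_apply_ne {i j : ι} (h : j ≠ i) (y : F i) :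
    L1Sum.singleCLM 𝕜 F i y j = 0 := by
  classical exact lp.single_apply_ne _ _ _ h

theorem L1Sum.norm_singleCLM_apply (i : ι) (y : F i) : ‖L1Sum.singleCLM 𝕜 F i y‖ = ‖y‖ := by
  classical exact lp.norm_single (by simp) i y

variable (𝕜 F) in
theorem L1Sum.isL1Decomposition [∀ i, FiniteDimensional 𝕜 (F i)] :
    IsL1Decomposition fun i => L1Sum.singleCLM 𝕜 F i ∘L L1Sum.evalCLM 𝕜 F i where
  idem i x := congrArg (L1Sum.singleCLM 𝕜 F i) (L1Sum.singleCLM_apply_self (𝕜 := 𝕜) i _)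
  orth i j h x := by
    have : L1Sum.evalCLM 𝕜 F i (L1Sum.singleCLM 𝕜 F j (L1Sum.evalCLM 𝕜 F j x)) = 0 :=
      L1Sum.singleCLM_apply_ne (𝕜 := 𝕜) h _
    simp [this]
  compact i := isCompactOperator_comp_of_finiteDimensional _ _
  hasSum_norm x := by
    have : (fun i => ‖(L1Sum.singleCLM 𝕜 F i ∘L L1Sum.evalCLM 𝕜 F i) x‖) = fun i => ‖x i‖ :=
      funext fun i => L1Sum.norm_singleCLM_apply (𝕜 := 𝕜) i (x i)
    rw [this]
    exact L1Sum.hasSum_norm x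

variable {X Y κ : Type*} [NormedAddCommGroup X] [NormedSpace 𝕜 X] [NormedAddCommGroup Y]
  [NormedSpace 𝕜 Y] {p : ι → X →L[𝕜] X} {q : κ → Y →L[𝕜] Y}

/-- The maximum norm makes the product a `c₀`-sum over the disjoint union of the index sets, so the
spaces in part (2) need no separate argument. -/
theorem IsC0Decomposition.prod (hp : IsC0Decomposition p) (hq : IsC0Decomposition q) :
    IsC0Decomposition (X := X × Y) (Sum.elim
      (fun i => ContinuousLinearMap.inl 𝕜 X Y ∘L p i ∘L ContinuousLinearMap.fst 𝕜 X Y)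
      fun j => ContinuousLinearMap.inr 𝕜 X Y ∘L q j ∘L ContinuousLinearMap.snd 𝕜 X Y) where
  idem := by
    rintro (i | j) ⟨x, y⟩
    · simp [hp.idem]
    · simp [hq.idem]
  orth := by
    rintro (i | i) (j | j) h ⟨x, y⟩
    · simp [hp.orth i j (by simpa using h)]
    · simp
    · simp
    · simp [hq.orth i j (by simpa using h)]
  compact := by
    rintro (i | j)
    · exact ((hp.compact i).comp_clm (ContinuousLinearMap.fst 𝕜 X Y)).clm_comp
        (ContinuousLinearMap.inl 𝕜 X Y)
    · exact ((hq.compact j).comp_clm (ContinuousLinearMap.snd 𝕜 X Y)).clm_comp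
        (ContinuousLinearMap.inr 𝕜 X Y)
  norm_apply_le := by
    rintro ⟨x, y⟩ (i | j)
    · simpa [Prod.norm_def] using Or.inl (hp.norm_apply_le x i)
    · simpa [Prod.norm_def] using Or.inr (hq.norm_apply_le y j)
  norm_le := by
    rintro ⟨x, y⟩ r hr h
    refine norm_prod_le_iff.2 ⟨hp.norm_le x r hr fun i => ?_, hq.norm_le y r hr fun j => ?_⟩
    · exact (norm_fst_le _).trans (h (Sum.inl i))
    · exact (norm_snd_le _).trans (h (Sum.inr j))
  finite := by
    rintro ⟨x, y⟩ ε hε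
    refine (((hp.finite x ε hε).image Sum.inl).union ((hq.finite y ε hε).image Sum.inr)).subset ?_
    rintro (i | j) h
    · exact Or.inl ⟨i, by simpa [Prod.norm_def, hε.not_ge] using h, rfl⟩
    · exact Or.inr ⟨j, by simpa [Prod.norm_def, hε.not_ge] using h, rfl⟩

variable (𝕜 X Y) in
/-- The inclusion of the first factor into the `ℓ₁`-product. -/
def inlL1 : X →L[𝕜] WithLp 1 (X × Y) :=
  (WithLp.prodContinuousLinearEquiv 1 𝕜 X Y).symm ∘L ContinuousLinearMap.inl 𝕜 X Y

variable (𝕜 X Y) in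
/-- The inclusion of the second factor into the `ℓ₁`-product. -/
def inrL1 : Y →L[𝕜] WithLp 1 (X × Y) :=
  (WithLp.prodContinuousLinearEquiv 1 𝕜 X Y).symm ∘L ContinuousLinearMap.inr 𝕜 X Y

variable (𝕜 X Y) in
/-- The projection of the `ℓ₁`-product onto its first factor. -/
def fstL1 : WithLp 1 (X × Y) →L[𝕜] X :=
  ContinuousLinearMap.fst 𝕜 X Y ∘L (WithLp.prodContinuousLinearEquiv 1 𝕜 X Y : _ →L[𝕜] X × Y)

variable (𝕜 X Y) in
/-- The projection of the `ℓ₁`-product onto its second factor. -/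
def sndL1 : WithLp 1 (X × Y) →L[𝕜] Y :=
  ContinuousLinearMap.snd 𝕜 X Y ∘L (WithLp.prodContinuousLinearEquiv 1 𝕜 X Y : _ →L[𝕜] X × Y)

@[simp] theorem fstL1_inlL1 (x : X) : fstL1 𝕜 X Y (inlL1 𝕜 X Y x) = x := rfl

@[simp] theorem sndL1_inlL1 (x : X) : sndL1 𝕜 X Y (inlL1 𝕜 X Y x) = 0 := rfl

@[simp] theorem fstL1_inrL1 (y : Y) : fstL1 𝕜 X Y (inrL1 𝕜 X Y y) = 0 := rfl

@[simp] theorem sndL1_inrL1 (y : Y) : sndL1 𝕜 X Y (inrL1 𝕜 X Y y) = y := rfl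

variable (𝕜) in
theorem norm_withLp_one (z : WithLp 1 (X × Y)) :
    ‖z‖ = ‖fstL1 𝕜 X Y z‖ + ‖sndL1 𝕜 X Y z‖ := by
  rw [WithLp.prod_norm_eq_add (by simp)]
  simp
  rfl

@[simp] theorem norm_inlL1 (x : X) : ‖inlL1 𝕜 X Y x‖ = ‖x‖ := by
  rw [norm_withLp_one 𝕜]
  simp

@[simp] theorem norm_inrL1 (y : Y) : ‖inrL1 𝕜 X Y y‖ = ‖y‖ := by
  rw [norm_withLp_one 𝕜]
  simp

theorem IsL1Decomposition.prod (hp : IsL1Decomposition p) (hq : IsL1Decomposition q) :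
    IsL1Decomposition (X := WithLp 1 (X × Y)) (Sum.elim
      (fun i => inlL1 𝕜 X Y ∘L p i ∘L fstL1 𝕜 X Y)
      fun j => inrL1 𝕜 X Y ∘L q j ∘L sndL1 𝕜 X Y) where
  idem := by
    rintro (i | j) z
    · simp [hp.idem]
    · simp [hq.idem]
  orth := by
    rintro (i | i) (j | j) h z
    · simp [hp.orth i j (by simpa using h)]
    · simp
    · simp
    · simp [hq.orth i j (by simpa using h)]
  compact := by
    rintro (i | j)
    · exact ((hp.compact i).comp_clm (fstL1 𝕜 X Y)).clm_comp (inlL1 𝕜 X Y)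
    · exact ((hq.compact j).comp_clm (sndL1 𝕜 X Y)).clm_comp (inrL1 𝕜 X Y)
  hasSum_norm z := by
    rw [norm_withLp_one 𝕜]
    refine HasSum.sum (f := fun k => _) ?_ ?_
    · simpa [Function.comp_def] using hp.hasSum_norm (fstL1 𝕜 X Y z)
    · simpa [Function.comp_def] using hq.hasSum_norm (sndL1 𝕜 X Y z)

end Concrete

/-! ### Infinite-dimensionality -/

section InfiniteDimensional

variable {𝕜 : Type*} [RCLike 𝕜]

/-- A compact identity forces finite dimension, but the biorthogonal functionals make the `v n`
linearly independent. -/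
theorem not_isCompactOperator_id_of_separated {X : Type*} [NormedAddCommGroup X] [NormedSpace 𝕜 X]
    {v : ℕ → X} {g : ℕ → X →L[𝕜] 𝕜} (h1 : ∀ n, g n (v n) ≠ 0) (h2 : ∀ m n, m ≠ n → g m (v n) = 0) :
    ¬ IsCompactOperator (ContinuousLinearMap.id 𝕜 X) := by
  intro h
  have : FiniteDimensional 𝕜 X := FiniteDimensional.of_isCompactOperator_id (𝕜 := 𝕜) h
  have hli : LinearIndependent 𝕜 v := by
    refine linearIndependent_iff'.2 fun s c hc n hn => ?_
    have h3 := congrArg (g n) hc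
    rw [map_sum, map_zero, Finset.sum_eq_single_of_mem n hn fun m _ hmn => by
      rw [map_smul, h2 n m hmn.symm, smul_zero], map_smul, smul_eq_mul] at h3
    exact (mul_eq_zero.1 h3).resolve_right (h1 n)
  exact not_finite_iff_infinite.2 inferInstance hli.finite

theorem not_isCompactOperator_id_C0 : ¬ IsCompactOperator (ContinuousLinearMap.id 𝕜 (C0 𝕜 ℕ)) :=
  not_isCompactOperator_id_of_separated (v := fun n => C0Sum.singleCLM 𝕜 (fun _ => 𝕜) n 1)
    (g := fun n => C0Sum.evalCLM 𝕜 (fun _ => 𝕜) n)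
    (fun n => (C0Sum.singleCLM_apply_self (𝕜 := 𝕜) (F := fun _ : ℕ => 𝕜) n 1).trans_ne one_ne_zero)
    fun _ _ h => C0Sum.singleCLM_apply_ne (𝕜 := 𝕜) (F := fun _ : ℕ => 𝕜) h 1

theorem not_isCompactOperator_id_L1 : ¬ IsCompactOperator (ContinuousLinearMap.id 𝕜 (L1 𝕜 ℕ)) :=
  not_isCompactOperator_id_of_separated (v := fun n => L1Sum.singleCLM 𝕜 (fun _ => 𝕜) n 1)
    (g := fun n => L1Sum.evalCLM 𝕜 (fun _ => 𝕜) n)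
    (fun n => (L1Sum.singleCLM_apply_self (𝕜 := 𝕜) (F := fun _ : ℕ => 𝕜) n 1).trans_ne one_ne_zero)
    fun _ _ h => L1Sum.singleCLM_apply_ne (𝕜 := 𝕜) (F := fun _ : ℕ => 𝕜) h 1

theorem not_isCompactOperator_id_hilbertC0 (Γ : Type*) :
    ¬ IsCompactOperator (ContinuousLinearMap.id 𝕜 (HilbertC0 𝕜 Γ)) := by
  let F : ℕ → Type _ := fun n => EuclideanSpace 𝕜 (Fin (n + 1))
  let e : ∀ n, F n := fun n => EuclideanSpace.single 0 1
  let f : ∀ n, F n →L[𝕜] 𝕜 := fun n => EuclideanSpace.proj 0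
  have hfe : ∀ n, f n (e n) = 1 := fun n => by
    change (EuclideanSpace.single (0 : Fin (n + 1)) (1 : 𝕜)) 0 = 1
    simp
  refine not_isCompactOperator_id_of_separated
    (v := fun n => (C0Sum.singleCLM 𝕜 F n (e n), 0))
    (g := fun n => f n ∘L C0Sum.evalCLM 𝕜 F n ∘L ContinuousLinearMap.fst 𝕜 _ _)
    (fun n => ?_) fun m n h => ?_
  · exact ((congrArg (f n) (C0Sum.singleCLM_apply_self (𝕜 := 𝕜) n _)).trans (hfe n)).trans_ne one_ne_zero
  · exact (congrArg (f m) (C0Sum.singleCLM_apply_ne (𝕜 := 𝕜) h _)).trans (map_zero _)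

theorem not_isCompactOperator_id_hilbertL1 (Γ : Type*) :
    ¬ IsCompactOperator (ContinuousLinearMap.id 𝕜 (HilbertL1 𝕜 Γ)) := by
  let F : ℕ → Type _ := fun n => EuclideanSpace 𝕜 (Fin (n + 1))
  let e : ∀ n, F n := fun n => EuclideanSpace.single 0 1
  let f : ∀ n, F n →L[𝕜] 𝕜 := fun n => EuclideanSpace.proj 0
  have hfe : ∀ n, f n (e n) = 1 := fun n => by
    change (EuclideanSpace.single (0 : Fin (n + 1)) (1 : 𝕜)) 0 = 1
    simp
  refine not_isCompactOperator_id_of_separated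
    (v := fun n => inlL1 𝕜 _ _ (L1Sum.singleCLM 𝕜 F n (e n)))
    (g := fun n => f n ∘L L1Sum.evalCLM 𝕜 F n ∘L fstL1 𝕜 _ _)
    (fun n => ?_) fun m n h => ?_
  · exact ((congrArg (f n) (L1Sum.singleCLM_apply_self (𝕜 := 𝕜) n _)).trans (hfe n)).trans_ne one_ne_zero
  · exact (congrArg (f m) (L1Sum.singleCLM_apply_ne (𝕜 := 𝕜) h _)).trans (map_zero _)

end InfiniteDimensional

/-! ### Consequences for the Calkin algebra -/

section Consequences

variable {𝕜 : Type*} [RCLike 𝕜] {E X : Type*} [NormedAddCommGroup E] [NormedSpace 𝕜 E]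
  [NormedAddCommGroup X] [NormedSpace 𝕜 X] [CompleteSpace X]

/-- The class of the identity is a non-zero idempotent, so submultiplicativity gives norm at least
`1`. -/
theorem essNorm_id (hX : ¬ IsCompactOperator (ContinuousLinearMap.id 𝕜 X)) :
    essNorm (ContinuousLinearMap.id 𝕜 X) = 1 := by
  have h1 : ‖(1 : Calkin 𝕜 X)‖ = essNorm (ContinuousLinearMap.id 𝕜 X) :=
    norm_mk_compactIdeal (ContinuousLinearMap.id 𝕜 X)
  have h2 : (1 : Calkin 𝕜 X) ≠ 0 := fun h =>
    hX ((Submodule.Quotient.mk_eq_zero (compactIdeal 𝕜 X)).1 h)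
  refine le_antisymm ?_ ?_
  · exact (Submodule.Quotient.norm_mk_le _ _).trans ContinuousLinearMap.norm_id_le
  · rw [← h1]
    have h3 := norm_mul_le (1 : Calkin 𝕜 X) 1
    rw [mul_one] at h3
    nlinarith [norm_pos_iff.2 h2]

theorem IdentityFactors.hasIFP (h : IdentityFactors 𝕜 E X X)
    (hX : ¬ IsCompactOperator (ContinuousLinearMap.id 𝕜 X))
    (hE : ¬ IsCompactOperator (ContinuousLinearMap.id 𝕜 E)) {C : ℝ} (hC : 1 < C) :
    HasIFP C (Calkin 𝕜 X) := by
  have hK : 1 < √C := Real.lt_sqrt_of_sq_lt (by simpa using hC)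
  -- Applied to the identity of `X`, the factorization yields a copy of `E` complemented by `J Q`;
  -- each of the two factorizations costs `√C`.
  obtain ⟨Q, J, hQJ, hQJn⟩ := h _ hX (essNorm_id hX) _ hK
  rw [ContinuousLinearMap.id_comp] at hQJ
  intro a ha
  obtain ⟨T, rfl⟩ := Submodule.Quotient.mk_surjective _ a
  have hT : ¬ IsCompactOperator T := fun hc => by
    rw [(Submodule.Quotient.mk_eq_zero (compactIdeal 𝕜 X)).2 hc, norm_zero] at ha
    exact zero_ne_one ha
  rw [norm_mk_compactIdeal] at ha
  obtain ⟨U, V, hUV, hUVn⟩ := h T hT ha _ hK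
  have e : (Submodule.Quotient.mk (J ∘L U) : Calkin 𝕜 X) * Submodule.Quotient.mk T *
      Submodule.Quotient.mk (V ∘L Q) = Submodule.Quotient.mk (J ∘L Q) := by
    refine congrArg (Submodule.Quotient.mk (p := compactIdeal 𝕜 X))
      (a₁ := (J ∘L U) ∘L T ∘L V ∘L Q) ?_
    ext x
    exact congrArg J (DFunLike.congr_fun hUV (Q x))
  have hidem : (J ∘L Q) ∘L (J ∘L Q) = J ∘L Q := by
    ext x
    exact congrArg J (DFunLike.congr_fun hQJ (Q x))
  refine ⟨Submodule.Quotient.mk (J ∘L U), Submodule.Quotient.mk (V ∘L Q), ?_, ?_, ?_⟩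
  · calc _ ≤ ‖J ∘L U‖ * ‖V ∘L Q‖ := by
          gcongr <;> exact Submodule.Quotient.norm_mk_le _ _
      _ ≤ (‖J‖ * ‖U‖) * (‖V‖ * ‖Q‖) := by
          gcongr <;> exact ContinuousLinearMap.opNorm_comp_le _ _
      _ = (‖U‖ * ‖V‖) * (‖Q‖ * ‖J‖) := by ring
      _ ≤ √C * √C := by gcongr
      _ = C := Real.mul_self_sqrt (by linarith)
  · rw [e]
    intro h0
    have hc : IsCompactOperator (J ∘L Q) :=
      (Submodule.Quotient.mk_eq_zero (compactIdeal 𝕜 X)).1 h0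
    refine hE ?_
    -- `Q (J Q) J = I_E`, so compactness of `J Q` would make `I_E` compact.
    convert! (hc.comp_clm J).clm_comp Q using 1
    ext x
    have h3 : ∀ y, Q (J y) = y := DFunLike.congr_fun hQJ
    simp [h3]
  · rw [e]
    exact congrArg (Submodule.Quotient.mk (p := compactIdeal 𝕜 X)) hidem

theorem HasIFP.uniformlyIncompressible.{z, t} {A : Type t} [NonUnitalNormedRing A]
    [NormedSpace 𝕜 A] [IsScalarTower 𝕜 A A] [SMulCommClass 𝕜 A A] (h : HasIFP 2 A) :
    UniformlyIncompressible.{z} 𝕜 A := by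
  -- For the idempotent `e = b (a / ‖a‖) c`, `1 ≤ ‖φ e‖ ≤ ‖φ‖² ‖b‖ ‖c‖ ‖φ a‖ / ‖a‖` with `‖b‖ ‖c‖ ≤
  -- 2`.
  refine ⟨fun t => (2 * t ^ 2)⁻¹, fun t ht => by positivity, ?_⟩
  intro B _ _ _ _ φ hmul hinj a
  by_cases ha : a = 0
  · simp [ha]
  have ha0 : 0 < ‖a‖ := norm_pos_iff.2 ha
  obtain ⟨b, c, hbc, hne, hid⟩ := h (((‖a‖ : 𝕜)⁻¹) • a) (by
    rw [norm_smul, norm_inv, RCLike.norm_ofReal, abs_of_pos ha0, inv_mul_cancel₀ ha0.ne'])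
  set e := b * (((‖a‖ : 𝕜)⁻¹) • a) * c with he
  have hφe : φ e * φ e = φ e := by rw [← hmul, hid.eq]
  have hφne : φ e ≠ 0 := fun h0 => hne (hinj (h0.trans (map_zero φ).symm))
  have h1 : 1 ≤ ‖φ e‖ := by
    have h2 := norm_mul_le (φ e) (φ e)
    rw [hφe] at h2
    nlinarith [norm_pos_iff.2 hφne]
  have h3 : ‖φ e‖ ≤ 2 * ‖φ‖ ^ 2 * (‖a‖⁻¹ * ‖φ a‖) := by
    calc ‖φ e‖ ≤ ‖φ b‖ * ‖φ (((‖a‖ : 𝕜)⁻¹) • a)‖ * ‖φ c‖ := by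
          rw [he, hmul, hmul]
          exact norm_mul₃_le
      _ ≤ (‖φ‖ * ‖b‖) * (‖a‖⁻¹ * ‖φ a‖) * (‖φ‖ * ‖c‖) := by
          rw [map_smul, norm_smul, norm_inv, RCLike.norm_ofReal, abs_of_pos ha0]
          gcongr <;> exact φ.le_opNorm _
      _ = (‖b‖ * ‖c‖) * (‖φ‖ ^ 2 * (‖a‖⁻¹ * ‖φ a‖)) := by ring
      _ ≤ 2 * (‖φ‖ ^ 2 * (‖a‖⁻¹ * ‖φ a‖)) := by gcongr
      _ = _ := by ring
  have hφ : 0 < ‖φ‖ := norm_pos_iff.2 fun h0 => hφne (by simp [h0])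
  have h4 := h1.trans h3
  rw [inv_mul_eq_div, div_le_iff₀ (by positivity)]
  calc ‖a‖ = 1 * ‖a‖ := (one_mul _).symm
    _ ≤ 2 * ‖φ‖ ^ 2 * (‖a‖⁻¹ * ‖φ a‖) * ‖a‖ := by gcongr
    _ = ‖φ a‖ * (2 * ‖φ‖ ^ 2) := by
      field_simp

theorem IdentityFactors.calkin.{z, t} {X : Type t} [NormedAddCommGroup X] [NormedSpace 𝕜 X]
    [CompleteSpace X] (h : IdentityFactors 𝕜 E X X)
    (hX : ¬ IsCompactOperator (ContinuousLinearMap.id 𝕜 X))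
    (hE : ¬ IsCompactOperator (ContinuousLinearMap.id 𝕜 E)) :
    IdentityFactors 𝕜 E X X ∧ (∀ C : ℝ, 1 < C → HasIFP C (Calkin 𝕜 X)) ∧
      UniformlyIncompressible.{z} 𝕜 (Calkin 𝕜 X) :=
  ⟨h, fun _ hC => h.hasIFP hX hE hC, (h.hasIFP hX hE one_lt_two).uniformlyIncompressible⟩

end Consequences

end CalkinIFP

end

theorem mainTheorem5 {𝕜 : Type u} [RCLike 𝕜] :
    (∀ (Γ : Type v₁) (Ξ : Type v₂) [Infinite Γ] [Infinite Ξ] (F : Γ → Type v₃) (G : Ξ → Type v₄)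
      [∀ γ, NormedAddCommGroup (F γ)] [∀ γ, NormedSpace 𝕜 (F γ)]
      [∀ γ, FiniteDimensional 𝕜 (F γ)] [∀ γ, Nontrivial (F γ)]
      [∀ ξ, NormedAddCommGroup (G ξ)] [∀ ξ, NormedSpace 𝕜 (G ξ)]
      [∀ ξ, FiniteDimensional 𝕜 (G ξ)] [∀ ξ, Nontrivial (G ξ)],
      CalkinIFP.IdentityFactors 𝕜 (CalkinIFP.C0 𝕜 ℕ)
          (CalkinIFP.C0Sum 𝕜 F) (CalkinIFP.C0Sum 𝕜 G) ∧
        CalkinIFP.IdentityFactors 𝕜 (CalkinIFP.L1 𝕜 ℕ)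
          (CalkinIFP.L1Sum F) (CalkinIFP.L1Sum G)) ∧
    (∀ Γ : Type v₅,
      (CalkinIFP.IdentityFactors 𝕜 (CalkinIFP.C0 𝕜 ℕ)
          (CalkinIFP.HilbertC0 𝕜 Γ) (CalkinIFP.HilbertC0 𝕜 Γ) ∧
        (∀ C : ℝ, 1 < C → CalkinIFP.HasIFP C (CalkinIFP.Calkin 𝕜 (CalkinIFP.HilbertC0 𝕜 Γ))) ∧
        CalkinIFP.UniformlyIncompressible.{w} 𝕜
          (CalkinIFP.Calkin 𝕜 (CalkinIFP.HilbertC0 𝕜 Γ))) ∧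
      (CalkinIFP.IdentityFactors 𝕜 (CalkinIFP.L1 𝕜 ℕ)
          (CalkinIFP.HilbertL1 𝕜 Γ) (CalkinIFP.HilbertL1 𝕜 Γ) ∧
        (∀ C : ℝ, 1 < C → CalkinIFP.HasIFP C (CalkinIFP.Calkin 𝕜 (CalkinIFP.HilbertL1 𝕜 Γ))) ∧
        CalkinIFP.UniformlyIncompressible.{w} 𝕜
          (CalkinIFP.Calkin 𝕜 (CalkinIFP.HilbertL1 𝕜 Γ)))) := by
  refine ⟨fun Γ Ξ _ _ F G _ _ _ _ _ _ _ _ => ?_, fun Γ => ?_⟩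
  · have : ∀ γ, CompleteSpace (F γ) := fun γ => FiniteDimensional.complete 𝕜 (F γ)
    have : ∀ ξ, CompleteSpace (G ξ) := fun ξ => FiniteDimensional.complete 𝕜 (G ξ)
    exact ⟨(CalkinIFP.C0Sum.isC0Decomposition 𝕜 F).identityFactors
        (CalkinIFP.C0Sum.isC0Decomposition 𝕜 G),
      (CalkinIFP.L1Sum.isL1Decomposition 𝕜 G).identityFactors⟩
  · have hc := (CalkinIFP.C0Sum.isC0Decomposition 𝕜
      (fun n : ℕ => EuclideanSpace 𝕜 (Fin (n + 1)))).prod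
        (CalkinIFP.C0Sum.isC0Decomposition 𝕜 (fun _ : Γ => 𝕜))
    have hl := (CalkinIFP.L1Sum.isL1Decomposition 𝕜
      (fun n : ℕ => EuclideanSpace 𝕜 (Fin (n + 1)))).prod
        (CalkinIFP.L1Sum.isL1Decomposition 𝕜 (fun _ : Γ => 𝕜))
    exact ⟨(hc.identityFactors hc).calkin (CalkinIFP.not_isCompactOperator_id_hilbertC0 Γ)
        CalkinIFP.not_isCompactOperator_id_C0,
      hl.identityFactors.calkin (CalkinIFP.not_isCompactOperator_id_hilbertL1 Γ)
        CalkinIFP.not_isCompactOperator_id_L1⟩
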